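/- An instance of the simultaneous assignment problem consists of a finite loopless graph $G=(V,E)$ (parallel edges allowed) with edge capacities and edge weights, a set $\mathcal H=\{H_1,\dots,H_k\}$ of $k$ distinct subgraphs $H_i=(V_i,E_i)$ of $G$ with degree bounds on their nodes, and a laminar system on $V$ with degree-sum bounds. For integers $m\ge 0$ and $l\ge 1$, a laminar $(m,l)$-cover of the instance is a sequence of not necessarily distinct edge sets $F_1,\dots,F_m\subseteq E$ such that every edge of $G$ is contained in at least $l$ of them and, for each $i\in\{1,\dots,m\}$, the sets $E_1\cap F_i,\dots,E_k\cap F_i$ form a laminar family (any two of them are comparable under inclusion or disjoint). Theorem. Let $1\le k'\le k$ be integers. (a) Let $\alpha(k,k')$ be the least value of $m/l$ such that every instance with $|\mathcal H|=k$, in which every edge lies in at most $k'$ of the subgraphs in $\mathcal H$, has a laminar $(m,l)$-cover. This minimum exists and $$\alpha(k,k')=\max_{0\le j\le k'-1}\ \frac{1}{k-j}\sum_{i=j+1}^{k'}\binom{k}{i}.$$ Moreover, there is a single such instance, with no isolated node in any subgraph in $\mathcal H$, all of whose laminar $(m,l)$-covers satisfy $m/l\ge\alpha(k,k')$. (b)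 There are an algorithm, a function $f:\mathbb N\to\mathbb N$ and a polynomial $p$ with non-negative integer coefficients, none of which depends on $k$, $k'$ or the instance, such that, for all $1\le k'\le k$ and every instance as in (a), given $k$, $k'$, the graph $G$ and the subgraphs in $\mathcal H$, the algorithm outputs $m$, $l$ and a laminar $(m,l)$-cover $F_1,\dots,F_m$ with $m/l=\alpha(k,k')$ after at most $f(k)\cdot p(|V|,|E|)$ steps. Here a step is a step of a unit-cost random access machine on natural numbers whose arithmetic operations are addition and truncated subtraction. -/

import Mathlib

open scoped Graph

universe u v

/-- A hypergraph, given as a set of hyperedges, is laminar if any two hyperedges are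
comparable or disjoint. -/
def IsLaminar {U : Type*} (F : Set (Set U)) : Prop :=
  ∀ X ∈ F, ∀ Y ∈ F, X ⊆ Y ∨ Y ⊆ X ∨ Disjoint X Y

/-- An instance of the (weighted, capacitated, degree-sum-constrained) simultaneous assignment
problem with `k` subgraphs: a finite loopless graph `G` (parallel edges allowed) with edge
capacities `c`, a set `{H 0, ..., H (k-1)}` of `k` (distinct) subgraphs of `G` with degree bounds
`b i` on the nodes of `H i`, a laminar system `L` on the nodes of `G` with degree-sum bounds `g`,
and edge weights `w`. -/
structure SAPInstance (α β : Type*) (k : ℕ) where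
  G : Graph α β
  finite_vertexSet : V(G).Finite
  finite_edgeSet : E(G).Finite
  loopless : G.Loopless
  c : E(G) → ℕ
  H : Fin k → Graph α β
  H_le : ∀ i, H i ≤ G
  H_injective : Function.Injective H
  b : (i : Fin k) → V(H i) → ℕ
  L : Set (Set α)
  L_subset : ∀ X ∈ L, X ⊆ V(G)
  L_laminar : IsLaminar L
  g : L → ℕ
  w : E(G) → ℕ

namespace SAPInstance

variable {α β : Type*} {k : ℕ}

/-- Every edge lies in at most `k'` of the subgraphs. -/
def EdgesInAtMost (I : SAPInstance α β k) (k' : ℕ) : Prop :=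
  ∀ e ∈ E(I.G), {i : Fin k | e ∈ E(I.H i)}.ncard ≤ k'

/-- The problem restricted to the edge set `F` is laminar: the edge sets of the subgraphs,
restricted to `F`, form a laminar hypergraph. -/
def LaminarOn (I : SAPInstance α β k) (F : Set β) : Prop :=
  IsLaminar (Set.range fun i : Fin k => E((I.H i).restrict F))

/-- `F 0, ..., F (m-1)` are (not necessarily distinct) sets of edges of `G` such that every edge
of `G` is contained in at least `l` of them. -/
def IsCover (I : SAPInstance α β k) (m l : ℕ) (F : Fin m → Set β) : Prop :=
  (∀ i, F i ⊆ E(I.G)) ∧ ∀ e ∈ E(I.G), l ≤ {i : Fin m | e ∈ F i}.ncard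

/-- An `(m,l)`-cover is laminar if the problem restricted to each of its members is laminar. -/
def IsLaminarCover (I : SAPInstance α β k) (m l : ℕ) (F : Fin m → Set β) : Prop :=
  I.IsCover m l F ∧ ∀ i, I.LaminarOn (F i)

end SAPInstance

/-- The ratios `m / l` (with `l ≥ 1`) such that every instance with `k` subgraphs in which every
edge lies in at most `k'` of the subgraphs has a laminar `(m,l)`-cover. -/
def laminarCoverRatios (k k' : ℕ) : Set ℚ :=
  {q | ∃ m l : ℕ, 0 < l ∧ q = (m : ℚ) / l ∧
    ∀ (α : Type u) (β : Type v) (I : SAPInstance α β k), I.EdgesInAtMost k' →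
      ∃ F : Fin m → Set β, I.IsLaminarCover m l F}

/-- `max_{0 ≤ j < k'} (1 / (k - j)) * ∑_{i = j+1}^{k'} (k choose i)`. -/
def laminarCoverValue (k k' : ℕ) (hk' : 1 ≤ k') : ℚ :=
  (Finset.range k').sup' (Finset.nonempty_range_iff.2 (Nat.one_le_iff_ne_zero.1 hk'))
    fun j => (1 / ((k : ℚ) - (j : ℚ))) * ∑ i ∈ Finset.Icc (j + 1) k', ((k.choose i : ℕ) : ℚ)

/-! The machine model: a random access machine with finitely many registers named by a program,
an unbounded memory, a read-only random access input and a write-only output, all holding natural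
numbers. The only arithmetic operations are addition and truncated subtraction, and every
operation has unit cost (this model is polynomially equivalent to Turing machines). -/

namespace RAM

/-- Expressions: constants, registers, memory and input cells (indirectly addressed), sums and
truncated differences. -/
inductive Expr : Type
  | lit : ℕ → Expr
  | reg : ℕ → Expr
  | mem : Expr → Expr
  | inp : Expr → Expr
  | plus : Expr → Expr → Expr
  | minus : Expr → Expr → Expr

/-- Programs. -/
inductive Prog : Type
  | skip : Prog
  | setReg : ℕ → Expr → Prog
  | setMem : Expr → Expr → Prog
  | output : Expr → Prog
  | seq : Prog → Prog → Prog
  | ite : Expr → Prog → Prog → Prog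
  | loop : Expr → Prog → Prog

/-- The contents of the registers and of the memory, and the numbers written so far. -/
structure State : Type where
  reg : ℕ → ℕ
  mem : ℕ → ℕ
  out : List ℕ

/-- The initial state: everything is zero and nothing has been written. -/
def State.init : State := ⟨fun _ => 0, fun _ => 0, []⟩

/-- The value of an expression on input `xs`; input cells beyond the end of `xs` read as `0`. -/
def Expr.eval (xs : List ℕ) (s : State) : Expr → ℕ
  | lit n => n
  | reg r => s.reg r
  | mem a => s.mem (a.eval xs s)
  | inp a => xs.getD (a.eval xs s) 0
  | plus a b => a.eval xs s + b.eval xs s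
  | minus a b => a.eval xs s - b.eval xs s

/-- The number of steps taken by the evaluation of an expression. -/
def Expr.cost : Expr → ℕ
  | lit _ => 1
  | reg _ => 1
  | mem a => a.cost + 1
  | inp a => a.cost + 1
  | plus a b => a.cost + b.cost + 1
  | minus a b => a.cost + b.cost + 1

/-- `Exec xs P s t s'`: on input `xs` and from state `s`, the program `P` halts after exactly `t`
steps in state `s'`. Each assignment, output and test takes one step in addition to the evaluation
of its expressions. -/
inductive Exec (xs : List ℕ) : Prog → State → ℕ → State → Prop
  | skip (s : State) : Exec xs .skip s 1 s
  | setReg (r : ℕ) (a : Expr) (s : State) :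
      Exec xs (.setReg r a) s (a.cost + 1)
        { s with reg := Function.update s.reg r (a.eval xs s) }
  | setMem (a b : Expr) (s : State) :
      Exec xs (.setMem a b) s (a.cost + b.cost + 1)
        { s with mem := Function.update s.mem (a.eval xs s) (b.eval xs s) }
  | output (a : Expr) (s : State) :
      Exec xs (.output a) s (a.cost + 1) { s with out := s.out ++ [a.eval xs s] }
  | seq {P Q : Prog} {s s' s'' : State} {t t' : ℕ} :
      Exec xs P s t s' → Exec xs Q s' t' s'' → Exec xs (.seq P Q) s (t + t') s''
  | ite_true {a : Expr} {P Q : Prog} {s s' : State} {t : ℕ} :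
      a.eval xs s ≠ 0 → Exec xs P s t s' → Exec xs (.ite a P Q) s (a.cost + 1 + t) s'
  | ite_false {a : Expr} {P Q : Prog} {s s' : State} {t : ℕ} :
      a.eval xs s = 0 → Exec xs Q s t s' → Exec xs (.ite a P Q) s (a.cost + 1 + t) s'
  | loop_true {a : Expr} {P : Prog} {s s' s'' : State} {t t' : ℕ} :
      a.eval xs s ≠ 0 → Exec xs P s t s' → Exec xs (.loop a P) s' t' s'' →
        Exec xs (.loop a P) s (a.cost + 1 + t + t') s''
  | loop_false {a : Expr} {P : Prog} {s : State} :
      a.eval xs s = 0 → Exec xs (.loop a P) s (a.cost + 1) s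

/-- On input `xs`, the program `P` halts after exactly `t` steps with output `ys`. -/
def Outputs (P : Prog) (xs : List ℕ) (t : ℕ) (ys : List ℕ) : Prop :=
  ∃ s : State, Exec xs P State.init t s ∧ s.out = ys

end RAM

open Classical in
/-- The characteristic list of a subset of `{0, ..., n-1}`. -/
noncomputable def bits {n : ℕ} (X : Set (Fin n)) : List ℕ :=
  List.ofFn fun a : Fin n => if a ∈ X then 1 else 0

/-- The input of the cover algorithm, for an instance whose graph has node set `{0, ..., n-1}` and
edge set `{0, ..., q-1}`: the numbers `k, k', n, q`, the two ends `x a, y a` of each edge `a`, and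
for each subgraph the characteristic lists of its node set and of its edge set. (The capacities,
bounds and weights play no role for covers and are not given to the algorithm.) -/
noncomputable def encodeInstance {n q k : ℕ} (k' : ℕ) (I : SAPInstance (Fin n) (Fin q) k)
    (x y : Fin q → Fin n) : List ℕ :=
  [k, k', n, q] ++ (List.ofFn fun a : Fin q => [(x a : ℕ), (y a : ℕ)]).flatten ++
    (List.ofFn fun i : Fin k => bits V(I.H i) ++ bits E(I.H i)).flatten

/-- The output of the cover algorithm: the numbers `m, l` and the characteristic list of each of
the `m` edge sets. -/
noncomputable def encodeCover {q : ℕ} (m l : ℕ) (F : Fin m → Set (Fin q)) : List ℕ :=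
  [m, l] ++ (List.ofFn fun i : Fin m => bits (F i)).flatten

/-! Call the set of subgraphs containing an edge the type of the edge. Only types matter for
laminarity: if the nonempty types occurring in `F` are ancestor sets of nodes of one rooted forest
on the `k` indices, then the restricted edge sets are laminar. The problem is thus a fractional
covering of the nonempty sets of size at most `k'` by such families.

Lower bound. In a laminar family of types of size greater than `j`, every type is determined by one
representative element, and a smallest type `T₀` contains no representative besides its own. So
there are at most `k - j` types (`card_le_of_laminar_stars`). Double counting in the instance with
one edge of each type of size at most `k'` gives every term of the maximum
(`mul_levelSum_le_of_isLaminarCover`).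

Upper bound. A spider is a path of `t` nodes (the body) with the other `k - t` nodes hung below its
end. Use all `k!` labellings of it, each with multiplicity `w_t = max(R_t - R_{t+1}, 0)`, where
`R_t` is `k!` times the `t`-th term of the maximum. A set of size `i + 1` is an ancestor set in at
least `(i+1)!(k-i-1)!` labellings if `t > i`, and in at least `(i+1)!(k-i)!` if `t = i`. The
recurrence `(k-t) R_t = k! (k choose t+1) + (k-t-1) R_{t+1}` then shows that each type is covered
`k!²` times (`factorial_mul_factorial_le_sum`). The number of sets used is `k! ∑ w_t`, and `∑ w_t =
max R_t` because `R` is unimodal (`scaledRatio_lt_of_lt`): the weights vanish before the peak and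
telescope after it.

Algorithm. The list of spiders depends on `k` and `k'` only, and whether an edge is taken depends on
its type, a bitmask below `2 ^ k`. These data are primitive recursive, hence computable by a program
whose time is a function of `k` and `k'` (`RAM.exists_computes`); what remains is a loop over
spiders and edges (`RAM.exists_coverProg`). -/

/-- `∑_{i = t+1}^{k'} (k choose i)`, the number of types of size more than `t`. -/
def levelSum (k k' t : ℕ) : ℕ := ∑ i ∈ Finset.Icc (t + 1) k', k.choose i

open scoped Nat in
/-- `k!` times the ratio `levelSum k k' t / (k - t)`. -/
def scaledRatio (k k' t : ℕ) : ℕ := levelSum k k' t * (k ! / (k - t))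

/-- The multiplicity with which spiders with a body of `t` nodes are used in the optimal cover. -/
def spiderWeight (k k' t : ℕ) : ℕ := scaledRatio k k' t - scaledRatio k k' (t + 1)

/-! ### Unimodality of the ratios and the total weight of the spiders. -/

section Weights

open scoped Nat

variable {k k' : ℕ}

lemma levelSum_self (k k' : ℕ) : levelSum k k' k' = 0 := by simp [levelSum]

lemma scaledRatio_self (k k' : ℕ) : scaledRatio k k' k' = 0 := by
  simp [scaledRatio, levelSum_self]

lemma levelSum_eq_choose_add {t : ℕ} (ht : t < k') :
    levelSum k k' t = k.choose (t + 1) + levelSum k k' (t + 1) := by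
  rw [levelSum, levelSum, ← Finset.add_sum_Ioc_eq_sum_Icc (by omega),
    ← Finset.Icc_add_one_left_eq_Ioc]

lemma sub_mul_scaledRatio {t : ℕ} (ht : t < k) :
    (k - t) * scaledRatio k k' t = k ! * levelSum k k' t := by
  have h : (k - t) * (k ! / (k - t)) = k ! :=
    Nat.mul_div_cancel' (Nat.dvd_factorial (by omega) (by omega))
  rw [scaledRatio, mul_left_comm, h, mul_comm]

/-- Exhibits each ratio as a weighted average, with weights `1` and `k - t - 1`, of a scaled
binomial coefficient and the next ratio. -/
lemma sub_mul_scaledRatio_eq_add (hk : k' ≤ k) {t : ℕ} (ht : t < k') :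
    (k - t) * scaledRatio k k' t =
      k ! * k.choose (t + 1) + (k - (t + 1)) * scaledRatio k k' (t + 1) := by
  rw [sub_mul_scaledRatio (by omega), levelSum_eq_choose_add ht, mul_add]
  rcases (show t + 1 < k ∨ t + 1 = k by omega) with h | h
  · rw [sub_mul_scaledRatio h]
  · obtain rfl : k' = t + 1 := by omega
    simp [levelSum_self, scaledRatio_self]

lemma choose_succ_le_of_half {i : ℕ} (h : k ≤ 2 * i + 1) :
    k.choose (i + 1) ≤ k.choose i := by
  have h1 := Nat.choose_succ_right_eq k i
  have h2 : k.choose i * (k - i) ≤ k.choose i * (i + 1) := Nat.mul_le_mul_left _ (by omega)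
  exact Nat.le_of_mul_le_mul_right (h1.trans_le h2) i.succ_pos

lemma choose_le_of_half {i j : ℕ} (h : k ≤ 2 * i + 1) (hij : i ≤ j) :
    k.choose j ≤ k.choose i := by
  induction j, hij using Nat.le_induction with
  | base => rfl
  | succ j hj ih => exact (choose_succ_le_of_half (by omega)).trans ih

/-- Once the ratios increase, they have been increasing before. -/
lemma scaledRatio_lt_of_lt (hk : k' ≤ k) {t : ℕ} (ht : t + 1 < k')
    (h : scaledRatio k k' (t + 1) < scaledRatio k k' (t + 2)) :
    scaledRatio k k' t < scaledRatio k k' (t + 1) := by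
  have ht2 : t + 2 < k' := by
    by_contra hc
    obtain rfl : k' = t + 2 := by omega
    simp [scaledRatio_self] at h
  have e1 := sub_mul_scaledRatio_eq_add (k := k) hk (t := t) (by omega)
  have e2 := sub_mul_scaledRatio_eq_add (k := k) hk (t := t + 1) (by omega)
  have e3 := sub_mul_scaledRatio (k := k) (k' := k') (t := t + 2) (by omega)
  obtain ⟨a, rfl⟩ : ∃ a, k = t + 3 + a := ⟨k - (t + 3), by omega⟩
  rw [show t + 3 + a - t = a + 3 by omega, show t + 3 + a - (t + 1) = a + 2 by omega] at e1
  rw [show t + 3 + a - (t + 1) = a + 2 by omega,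
    show t + 3 + a - (t + 1 + 1) = a + 1 by omega] at e2
  rw [show t + 3 + a - (t + 2) = a + 1 by omega] at e3
  simp only [add_assoc, Nat.reduceAdd] at e1 e2 e3 h ⊢
  set C1 := (t + (3 + a)).choose (t + 1) with hC1
  set C2 := (t + (3 + a)).choose (t + 2) with hC2
  set D := (t + (3 + a))! with hD
  set X0 := scaledRatio (t + (3 + a)) k' t
  set X1 := scaledRatio (t + (3 + a)) k' (t + 1)
  set X2 := scaledRatio (t + (3 + a)) k' (t + 2)
  -- By `e2`, `X1` is a weighted average of `D * C2` and `X2`. It lies below `X2`, so `D * C2` lies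
  -- below both.
  have h2 : D * C2 < X2 := by nlinarith
  have h1 : D * C2 < X1 := by nlinarith
  -- Otherwise the binomial coefficients no longer increase from `t + 2` on, so `X2`, formed from at
  -- most `a + 1` later ones divided by `a + 1`, could not exceed `D * C2`.
  have h12 : C1 ≤ C2 := by
    by_contra! hc
    have hhalf : t + (3 + a) ≤ 2 * (t + 2) + 1 := by
      by_contra! hh
      have := Nat.choose_succ_right_eq (t + (3 + a)) (t + 1)
      rw [show t + 1 + 1 = t + 2 by omega, ← hC1, ← hC2,
        show t + (3 + a) - (t + 1) = a + 2 by omega] at this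
      nlinarith
    have hle : levelSum (t + (3 + a)) k' (t + 2) ≤ (a + 1) * C2 := by
      rw [levelSum]
      refine (Finset.sum_le_card_nsmul _ _ C2 fun i hi => ?_).trans ?_
      · exact choose_le_of_half hhalf (by have := (Finset.mem_Icc.1 hi).1; omega)
      · rw [smul_eq_mul, Nat.card_Icc]
        exact Nat.mul_le_mul_right _ (by omega)
    have : (a + 1) * X2 ≤ (a + 1) * (D * C2) := by
      rw [e3, mul_left_comm]
      exact Nat.mul_le_mul_left _ hle
    nlinarith
  -- By `e1`, `X0` is a weighted average of `D * C1` and `X1`, hence below `X1`.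
  have h3 : D * C1 < X1 := (Nat.mul_le_mul_left _ h12).trans_lt h1
  refine Nat.lt_of_mul_lt_mul_left (a := a + 3) ?_
  rw [e1]
  linarith

lemma scaledRatio_lt_of_lt_of_le (hk : k' ≤ k) {s t : ℕ} (hst : s ≤ t) (ht : t < k')
    (h : scaledRatio k k' t < scaledRatio k k' (t + 1)) :
    scaledRatio k k' s < scaledRatio k k' (s + 1) := by
  induction t, hst using Nat.le_induction with
  | base => exact h
  | succ t _ ih => exact ih (by omega) (scaledRatio_lt_of_lt hk ht h)

/-- Telescoping down to the ratio `0` at `k'`; truncating the negative differences only increases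
the sum. -/
lemma scaledRatio_le_sum_spiderWeight {t : ℕ} (ht : t ≤ k') :
    scaledRatio k k' t ≤ ∑ s ∈ Finset.Ico t k', spiderWeight k k' s := by
  induction ht using Nat.decreasingInduction with
  | self => simp [scaledRatio_self]
  | of_succ t ht ih =>
    rw [Finset.sum_eq_sum_Ico_succ_bot ht]
    have : spiderWeight k k' t = scaledRatio k k' t - scaledRatio k k' (t + 1) := rfl
    omega

/-- Take for `j` the first index at which the ratios do not increase. The weights before `j` are
truncated to zero, and by unimodality those from `j` on are true differences. -/
lemma exists_sum_spiderWeight_eq (hk' : 1 ≤ k') (hk : k' ≤ k) :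
    ∃ j < k', ∑ s ∈ Finset.range k', spiderWeight k k' s = scaledRatio k k' j := by
  have hex : ∃ j, j < k' ∧ scaledRatio k k' (j + 1) ≤ scaledRatio k k' j :=
    ⟨k' - 1, by omega, by rw [Nat.sub_add_cancel hk', scaledRatio_self]; exact Nat.zero_le _⟩
  classical
  obtain ⟨hj, hle⟩ := Nat.find_spec hex
  set j := Nat.find hex
  have key : ∀ t, j ≤ t → t ≤ k' →
      ∑ s ∈ Finset.Ico t k', spiderWeight k k' s = scaledRatio k k' t := by
    intro t hjt htk
    induction htk using Nat.decreasingInduction with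
    | self => simp [scaledRatio_self]
    | of_succ t ht ih =>
      rw [Finset.sum_eq_sum_Ico_succ_bot ht, ih (by omega)]
      have : scaledRatio k k' (t + 1) ≤ scaledRatio k k' t := by
        by_contra! hc
        exact absurd (scaledRatio_lt_of_lt_of_le hk hjt ht hc) (by omega)
      rw [spiderWeight]
      omega
  refine ⟨j, hj, ?_⟩
  rw [← key j le_rfl hj.le, Finset.range_eq_Ico,
    ← Finset.sum_Ico_consecutive _ (Nat.zero_le j) hj.le, Nat.add_eq_right]
  refine Finset.sum_eq_zero fun s hs => ?_
  have := Nat.find_min hex (Finset.mem_Ico.1 hs).2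
  have hs' := (Finset.mem_Ico.1 hs).2
  rw [spiderWeight]
  have : ¬ scaledRatio k k' (s + 1) ≤ scaledRatio k k' s := fun h => this ⟨by omega, h⟩
  omega

/-- The covering inequality for types of size `i + 1`, up to a common factorial factor: spiders with
a body of exactly `i` nodes count `k - i` times as much as those with a longer body. -/
lemma factorial_mul_choose_le_spiderWeight (hk : k' ≤ k) {i : ℕ} (hi : i < k') :
    k ! * k.choose (i + 1) ≤ (k - i) * spiderWeight k k' i +
      ∑ s ∈ Finset.Ico (i + 1) k', spiderWeight k k' s := by
  have h1 := scaledRatio_le_sum_spiderWeight (k := k) (t := i + 1) (k' := k') hi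
  have h2 := sub_mul_scaledRatio_eq_add hk hi
  have h3 : scaledRatio k k' i ≤ spiderWeight k k' i + scaledRatio k k' (i + 1) := by
    rw [spiderWeight]; omega
  obtain ⟨a, ha⟩ : ∃ a, k - i = a + 1 := ⟨k - i - 1, by omega⟩
  rw [show k - (i + 1) = a by omega, ha] at h2
  rw [ha]
  nlinarith

lemma cast_scaledRatio_div (k' : ℕ) {j : ℕ} (hj : j < k) :
    (scaledRatio k k' j : ℚ) / k ! =
      1 / ((k : ℚ) - (j : ℚ)) * ∑ i ∈ Finset.Icc (j + 1) k', ((k.choose i : ℕ) : ℚ) := by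
  have h := sub_mul_scaledRatio (k' := k') hj
  have h' : ((k : ℚ) - j) * scaledRatio k k' j = k ! * levelSum k k' j := by
    rw [← Nat.cast_sub hj.le]; exact_mod_cast h
  have h0 : (k : ℚ) - j ≠ 0 := sub_ne_zero.2 (by exact_mod_cast hj.ne')
  have h1 : (k ! : ℚ) ≠ 0 := by exact_mod_cast k.factorial_ne_zero
  rw [← Nat.cast_sum, ← levelSum]
  field_simp
  linear_combination h'

lemma sum_spiderWeight_div_eq (hk' : 1 ≤ k') (hk : k' ≤ k) :
    ((∑ s ∈ Finset.range k', spiderWeight k k' s : ℕ) : ℚ) / k ! =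
      laminarCoverValue k k' hk' := by
  have hpos : (0 : ℚ) < k ! := by exact_mod_cast k.factorial_pos
  apply le_antisymm
  · obtain ⟨j, hj, h⟩ := exists_sum_spiderWeight_eq hk' hk
    rw [h, cast_scaledRatio_div k' (hj.trans_le hk)]
    exact Finset.le_sup' (fun j : ℕ => 1 / ((k : ℚ) - (j : ℚ)) *
      ∑ i ∈ Finset.Icc (j + 1) k', ((k.choose i : ℕ) : ℚ)) (Finset.mem_range.2 hj)
  · refine Finset.sup'_le _ _ fun j hj => ?_
    have hj := Finset.mem_range.1 hj
    rw [← cast_scaledRatio_div k' (hj.trans_le hk)]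
    gcongr
    refine (scaledRatio_le_sum_spiderWeight hj.le).trans (Finset.sum_le_sum_of_subset ?_)
    rw [Finset.range_eq_Ico]
    exact Finset.Ico_subset_Ico (Nat.zero_le _) le_rfl

end Weights

/-! ### Spiders: encoding by numbers, counting, and laminarity. -/

/-- The `x`-th digit of `c` in base `k`: the rank of `x` in the ranking encoded by `c`. -/
def codeRank (k c x : ℕ) : ℕ := c / k ^ x % k

/-- The codes of the injective rankings of `{0, ..., k-1}`. -/
def injectiveCodes (k : ℕ) : List ℕ :=
  (List.range (k ^ k)).filter fun c =>
    ∀ x < k, ∀ y < k, codeRank k c x = codeRank k c y → x = y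

/-- The spider with a body of `t` nodes given by the ranking `r` consists of the ancestor sets
of all nodes; we also allow the empty type. -/
def IsSpiderType {k : ℕ} (t : ℕ) (r : Fin k → ℕ) (S : Set (Fin k)) : Prop :=
  S = ∅ ∨ ∃ y, ∀ x, x ∈ S ↔ x = y ∨ (r x < t ∧ r x < r y)

/-- The bitmask version of `IsSpiderType`. -/
def IsSpiderMask (k t c T : ℕ) : Prop :=
  T = 0 ∨ ∃ y < k, ∀ x < k,
    (T / 2 ^ x % 2 = 1 ↔ x = y ∨ (codeRank k c x < t ∧ codeRank k c x < codeRank k c y))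

instance (k t c T : ℕ) : Decidable (IsSpiderMask k t c T) := by
  unfold IsSpiderMask; infer_instance

/-- The spiders of the optimal cover: pairs of a body size and the code of a ranking. -/
def coverList (k k' : ℕ) : List (ℕ × ℕ) :=
  (List.range k').flatMap fun t =>
    (List.range (spiderWeight k k' t)).flatMap fun _ => (injectiveCodes k).map fun c => (t, c)

open Classical in
/-- The bitmask of a subset of `{0, ..., k-1}`. -/
noncomputable def bitmask {k : ℕ} (S : Set (Fin k)) : ℕ :=
  ∑ i : Fin k, if i ∈ S then 2 ^ (i : ℕ) else 0

section Spiders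

open scoped Nat

variable {k k' : ℕ}

lemma codeRank_finFunctionFinEquiv (f : Fin k → Fin k) (x : Fin k) :
    codeRank k (finFunctionFinEquiv f) x = f x := by
  conv_rhs => rw [← finFunctionFinEquiv.symm_apply_apply f]
  rfl

lemma bitmask_eq_finFunctionFinEquiv (S : Set (Fin k)) [DecidablePred (· ∈ S)] :
    bitmask S = finFunctionFinEquiv (fun i => if i ∈ S then (1 : Fin 2) else 0) := by
  rw [bitmask, finFunctionFinEquiv_apply]
  refine Finset.sum_congr rfl fun i _ => ?_
  split_ifs <;> simp

lemma bitmask_digit (S : Set (Fin k)) (x : Fin k) :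
    bitmask S / 2 ^ (x : ℕ) % 2 = 1 ↔ x ∈ S := by
  classical
  have h : bitmask S / 2 ^ (x : ℕ) % 2 = ((if x ∈ S then (1 : Fin 2) else 0 : Fin 2) : ℕ) := by
    rw [bitmask_eq_finFunctionFinEquiv]
    have := congrFun (finFunctionFinEquiv.symm_apply_apply
      (fun i => if i ∈ S then (1 : Fin 2) else 0)) x
    exact congrArg Fin.val this
  rw [h]
  split_ifs with hx <;> simp [hx]

lemma bitmask_eq_zero {S : Set (Fin k)} : bitmask S = 0 ↔ S = ∅ := by
  constructor
  · intro h
    refine Set.eq_empty_of_forall_notMem fun x hx => ?_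
    have := (bitmask_digit S x).2 hx
    simp [h] at this
  · rintro rfl
    simp [bitmask]

/-- Links the sets used in the counting to the numbers used by the algorithm. -/
lemma isSpiderMask_bitmask {t c : ℕ} {S : Set (Fin k)} :
    IsSpiderMask k t c (bitmask S) ↔ IsSpiderType t (fun x : Fin k => codeRank k c x) S := by
  rw [IsSpiderMask, IsSpiderType, bitmask_eq_zero]
  refine or_congr Iff.rfl ⟨?_, ?_⟩
  · rintro ⟨y, hy, h⟩
    refine ⟨⟨y, hy⟩, fun x => ?_⟩
    rw [← bitmask_digit, h x x.2, Fin.ext_iff]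
  · rintro ⟨y, h⟩
    refine ⟨y, y.2, fun x hx => ?_⟩
    rw [bitmask_digit S ⟨x, hx⟩, h, Fin.ext_iff]

lemma codeRank_injective {c : ℕ} (hc : c ∈ injectiveCodes k) :
    Function.Injective fun x : Fin k => codeRank k c x := by
  have h := (List.mem_filter.1 hc).2
  rw [decide_eq_true_iff] at h
  exact fun x y hxy => Fin.ext (h x x.2 y y.2 hxy)

/-- Reading base-`k` digits is a bijection from the injective codes to the numberings of `Fin k`, so
counts over the list reduce to counts of permutations. -/
lemma countP_injectiveCodes (q : (Fin k → ℕ) → Prop) [DecidablePred q] :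
    (injectiveCodes k).countP (fun c => q fun x => codeRank k c x) =
      Finset.card {σ : Numbering (Fin k) | q fun x => σ x} := by
  rw [injectiveCodes, List.countP_filter]
  have e : ∀ p : ℕ → Bool, (List.range (k ^ k)).countP p =
      ((Finset.range (k ^ k)).filter fun c => p c = true).card := by
    intro p
    rw [Finset.card, Finset.filter_val, ← Multiset.countP_eq_card_filter]
    simp [Finset.range, Multiset.range]
  rw [e]
  symm
  have hcode : ∀ (σ : Numbering (Fin k)) (x : Fin k),
      codeRank k (finFunctionFinEquiv fun x => finCongr (Fintype.card_fin k) (σ x)) x = σ x := by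
    intro σ x
    rw [codeRank_finFunctionFinEquiv]
    rfl
  refine Finset.card_bij
    (fun σ _ => (finFunctionFinEquiv fun x => finCongr (Fintype.card_fin k) (σ x) : ℕ)) ?_ ?_ ?_
  · intro σ hσ
    simp only [Finset.mem_filter, Finset.mem_univ, true_and, Finset.mem_range, Fin.is_lt,
      Bool.and_eq_true, decide_eq_true_iff] at hσ ⊢
    refine ⟨?_, fun x hx y hy hxy => ?_⟩
    · simp only [hcode]
      exact hσ
    · have h1 := hcode σ ⟨x, hx⟩
      have h2 := hcode σ ⟨y, hy⟩
      simp only at h1 h2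
      rw [h1, h2] at hxy
      exact congrArg Fin.val (σ.injective (Fin.ext hxy))
  · intro σ _ τ _ h
    refine Equiv.ext fun x => Fin.ext ?_
    rw [← hcode σ, ← hcode τ, h]
  · intro c hc
    simp only [Finset.mem_filter, Finset.mem_range, Bool.and_eq_true, decide_eq_true_iff] at hc
    obtain ⟨hck, hq, hinj⟩ := hc
    have hi : Function.Injective (finFunctionFinEquiv.symm ⟨c, hck⟩ : Fin k → Fin k) :=
      fun x y hxy => Fin.ext (hinj x x.2 y y.2 (congrArg Fin.val hxy))
    let σ : Numbering (Fin k) := (Equiv.ofBijective _ (Finite.injective_iff_bijective.1 hi)).trans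
      (finCongr (Fintype.card_fin k).symm)
    have hσ : (fun x => finCongr (Fintype.card_fin k) (σ x)) =
        (finFunctionFinEquiv.symm ⟨c, hck⟩ : Fin k → Fin k) := rfl
    refine ⟨σ, ?_, ?_⟩
    · simp only [Finset.mem_filter, Finset.mem_univ, true_and]
      exact hq
    · simp only [hσ, Equiv.apply_symm_apply]

lemma length_injectiveCodes (k : ℕ) : (injectiveCodes k).length = k ! := by
  have h := countP_injectiveCodes (k := k) (fun _ => True)
  simpa [Fintype.card_equiv (Fintype.equivFin (Fin k))] using h

lemma countP_coverList (p : ℕ × ℕ → Bool) :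
    (coverList k k').countP p = ∑ t ∈ Finset.range k',
      spiderWeight k k' t * (injectiveCodes k).countP (fun c => p (t, c)) := by
  have hsum : ∀ (n : ℕ) (f : ℕ → ℕ),
      ((List.range n).map f).sum = ∑ t ∈ Finset.range n, f t := by
    intro n f
    induction n with
    | zero => rfl
    | succ n ih => simp [List.range_succ, Finset.sum_range_succ, ih]
  simp [coverList, List.countP_flatMap, List.countP_map, Function.comp_def, hsum]

lemma length_coverList (k k' : ℕ) :
    (coverList k k').length = (∑ t ∈ Finset.range k', spiderWeight k k' t) * k ! := by
  have := countP_coverList (k := k) (k' := k') (fun _ => true)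
  simpa [length_injectiveCodes, Finset.sum_mul] using this

lemma isSpiderType_of_isPrefix {S : Finset (Fin k)} {σ : Numbering (Fin k)} {t : ℕ}
    (hS : S.Nonempty) (ht : S.card ≤ t) (h : σ.IsPrefix S) :
    IsSpiderType t (fun x => σ x) (S : Set (Fin k)) := by
  obtain ⟨y, hy, hmax⟩ := S.exists_max_image (fun x => σ x) hS
  have hcard : ((σ y : ℕ) + 1) = S.card := by
    have h1 := (h y).1 hy
    -- If some element of `S` were missing below `y`, the node ranked just after `y` would belong to
    -- the prefix `S`, against the choice of `y`.
    by_contra hne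
    have hlt : (σ y : ℕ) + 1 < S.card := by omega
    have hz := (h (σ.symm ⟨(σ y : ℕ) + 1, hlt.trans_le (Finset.card_le_univ S)⟩)).2
      (by simpa using hlt)
    have := hmax _ hz
    simp [Fin.le_def] at this
  refine Or.inr ⟨y, fun x => ?_⟩
  rw [Finset.mem_coe, h x]
  beta_reduce
  constructor
  · intro hx
    rcases eq_or_ne x y with rfl | hxy
    · exact Or.inl rfl
    · have : (σ x : ℕ) ≠ σ y := fun h => hxy (σ.injective (Fin.ext h))
      exact Or.inr ⟨by omega, by omega⟩
  · rintro (rfl | ⟨-, hx⟩)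
    · omega
    · omega

/-- Here `S.erase y` is the whole body and `y` is one of the legs. -/
lemma isSpiderType_of_isPrefix_erase {S : Finset (Fin k)} {σ : Numbering (Fin k)} {y : Fin k}
    (hy : y ∈ S) (h : σ.IsPrefix (S.erase y)) :
    IsSpiderType (S.card - 1) (fun x => σ x) (S : Set (Fin k)) := by
  refine Or.inr ⟨y, fun x => ?_⟩
  have h1 := h x
  have h2 := h y
  rw [Finset.card_erase_of_mem hy] at h1 h2
  simp only [Finset.mem_erase, hy, Finset.mem_coe, ne_eq, not_true_eq_false, false_and,
    false_iff, not_lt] at h1 h2 ⊢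
  by_cases hxy : x = y
  · simp [hxy, hy]
  · simp only [hxy, not_false_eq_true, true_and, false_or] at h1 ⊢
    rw [h1]
    exact ⟨fun h => ⟨h, h.trans_le h2⟩, fun h => h.1⟩

open Classical in
lemma card_isSpiderType_ge {S : Finset (Fin k)} (hS : S.Nonempty) {t : ℕ} (ht : S.card ≤ t) :
    (S.card)! * (k - S.card)! ≤
      Finset.card {σ : Numbering (Fin k) | IsSpiderType t (fun x => σ x) (S : Set (Fin k))} := by
  have h := Numbering.card_prefixed S
  rw [Fintype.card_fin] at h
  rw [← h]
  refine Finset.card_le_card fun σ hσ => ?_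
  simp only [Finset.mem_filter, Finset.mem_univ, true_and]
  exact isSpiderType_of_isPrefix hS ht (Numbering.mem_prefixed.1 hσ)

open Classical in
lemma card_isSpiderType_pred_ge {S : Finset (Fin k)} (hS : S.Nonempty) :
    (S.card)! * (k + 1 - S.card)! ≤ Finset.card
      {σ : Numbering (Fin k) | IsSpiderType (S.card - 1) (fun x => σ x) (S : Set (Fin k))} := by
  have hpos := hS.card_pos
  -- Two prefixes of one numbering are comparable, whereas `S.erase y` and `S.erase z` are not, so
  -- the choices of the leg can be added up.
  have hdisj : (S : Set (Fin k)).PairwiseDisjoint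
      fun y => Numbering.prefixed (S.erase y) := by
    intro y hy z hz hyz
    refine Numbering.disjoint_prefixed_prefixed ?_ ?_
    · exact fun h => (Finset.notMem_erase z S) (h (Finset.mem_erase.2 ⟨hyz.symm, hz⟩))
    · exact fun h => (Finset.notMem_erase y S) (h (Finset.mem_erase.2 ⟨hyz, hy⟩))
  have hcard := Finset.card_biUnion hdisj
  have hle : (S.biUnion fun y => Numbering.prefixed (S.erase y)).card ≤ Finset.card
      {σ : Numbering (Fin k) | IsSpiderType (S.card - 1) (fun x => σ x) (S : Set (Fin k))} := by
    refine Finset.card_le_card fun σ hσ => ?_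
    simp only [Finset.mem_biUnion, Numbering.mem_prefixed] at hσ
    obtain ⟨y, hy, h⟩ := hσ
    simp only [Finset.mem_filter, Finset.mem_univ, true_and]
    exact isSpiderType_of_isPrefix_erase hy h
  refine le_trans (le_of_eq ?_) hle
  rw [hcard, Finset.sum_congr rfl fun y hy => show _ = (S.card - 1)! * (k + 1 - S.card)! by
    rw [Numbering.card_prefixed, Finset.card_erase_of_mem hy, Fintype.card_fin]
    congr 2
    omega, Finset.sum_const, smul_eq_mul, ← mul_assoc, Nat.mul_factorial_pred hpos.ne']

open Classical in
lemma factorial_mul_factorial_le_sum (hk : k' ≤ k) {S : Finset (Fin k)} (hS : S.Nonempty)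
    (hS' : S.card ≤ k') :
    k ! * k ! ≤ ∑ t ∈ Finset.range k', spiderWeight k k' t * Finset.card
      {σ : Numbering (Fin k) | IsSpiderType t (fun x => σ x) (S : Set (Fin k))} := by
  have hpos := hS.card_pos
  obtain ⟨i, hi⟩ : ∃ i, S.card = i + 1 := ⟨S.card - 1, by omega⟩
  have hik : i < k' := by omega
  have h0 := card_isSpiderType_pred_ge hS
  have h1 := fun t (ht : S.card ≤ t) => card_isSpiderType_ge hS ht
  rw [hi] at h1 h0
  rw [Finset.range_eq_Ico, ← Finset.sum_Ico_consecutive _ (Nat.zero_le i) hik.le,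
    Finset.sum_eq_sum_Ico_succ_bot hik]
  set A := fun t => Finset.card
    {σ : Numbering (Fin k) | IsSpiderType t (fun x => σ x) (S : Set (Fin k))} with hA
  have e0 : (i + 1)! * ((k - (i + 1))! * (k - i)) ≤ A i := by
    refine le_trans (le_of_eq ?_) h0
    obtain ⟨a, ha⟩ : ∃ a, k - i = a + 1 := ⟨k - i - 1, by omega⟩
    rw [show k + 1 - (i + 1) = a + 1 by omega, show k - (i + 1) = a by omega, ha,
      Nat.factorial_succ a, mul_comm (a + 1)]
  have e1 : (∑ t ∈ Finset.Ico (i + 1) k', spiderWeight k k' t) * ((i + 1)! * (k - (i + 1))!) ≤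
      ∑ t ∈ Finset.Ico (i + 1) k', spiderWeight k k' t * A t := by
    rw [Finset.sum_mul]
    exact Finset.sum_le_sum fun t ht => Nat.mul_le_mul_left _ (h1 t (Finset.mem_Ico.1 ht).1)
  have e2 := factorial_mul_choose_le_spiderWeight hk hik
  have e3 := Nat.choose_mul_factorial_mul_factorial (show i + 1 ≤ k by omega)
  calc k ! * k ! = k ! * k.choose (i + 1) * ((i + 1)! * (k - (i + 1))!) := by
        conv_lhs => rw [← e3]
        rw [e3]; nth_rw 2 [← e3]; ring
    _ ≤ ((k - i) * spiderWeight k k' i +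
          ∑ s ∈ Finset.Ico (i + 1) k', spiderWeight k k' s) * ((i + 1)! * (k - (i + 1))!) :=
        Nat.mul_le_mul_right _ e2
    _ = spiderWeight k k' i * ((i + 1)! * ((k - (i + 1))! * (k - i))) +
          (∑ s ∈ Finset.Ico (i + 1) k', spiderWeight k k' s) *
            ((i + 1)! * (k - (i + 1))!) := by ring
    _ ≤ spiderWeight k k' i * A i +
          ∑ t ∈ Finset.Ico (i + 1) k', spiderWeight k k' t * A t :=
        add_le_add (Nat.mul_le_mul_left _ e0) e1
    _ ≤ _ := Nat.le_add_left _ _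

lemma factorial_mul_factorial_le_countP_of_nonempty (hk : k' ≤ k) {S : Set (Fin k)}
    (hne : S.Nonempty) (hS : S.ncard ≤ k') :
    k ! * k ! ≤
      (coverList k k').countP fun s => IsSpiderMask k s.1 s.2 (bitmask S) := by
  classical
  rw [countP_coverList]
  have h := factorial_mul_factorial_le_sum hk (S := S.toFinset) (by simpa)
    (by rwa [← Set.ncard_eq_toFinset_card'])
  refine h.trans (le_of_eq (Finset.sum_congr rfl fun t _ => ?_))
  rw [← countP_injectiveCodes fun r => IsSpiderType t r (S.toFinset : Set (Fin k))]
  simp only [isSpiderMask_bitmask, Set.coe_toFinset]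

lemma factorial_mul_factorial_le_countP (hk' : 1 ≤ k') (hk : k' ≤ k) (S : Set (Fin k))
    (hS : S.ncard ≤ k') :
    k ! * k ! ≤
      (coverList k k').countP fun s => IsSpiderMask k s.1 s.2 (bitmask S) := by
  rcases S.eq_empty_or_nonempty with rfl | hne
  -- The empty type belongs to every spider, so a lower bound on the length of the list suffices;
  -- any singleton provides one.
  · have h := factorial_mul_factorial_le_countP_of_nonempty hk
      (Set.singleton_nonempty (⟨0, by omega⟩ : Fin k)) (by simpa)
    refine h.trans (List.countP_le_length.trans (le_of_eq ?_))
    symm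
    rw [List.countP_eq_length]
    intro s _
    rw [decide_eq_true_iff, isSpiderMask_bitmask]
    exact Or.inl rfl
  · exact factorial_mul_factorial_le_countP_of_nonempty hk hne hS

lemma ncard_getElem (l : List (ℕ × ℕ)) (p : ℕ × ℕ → Prop) [DecidablePred p] :
    {i : Fin l.length | p (l.get i)}.ncard = l.countP p := by
  rw [Set.ncard_eq_toFinset_card', Set.toFinset_ofPred, Finset.card, Finset.filter_val,
    ← Multiset.countP_eq_card_filter]
  conv_rhs => rw [← List.ofFn_get l, List.ofFn_eq_map, List.countP_map]
  rfl

/-- An edge whose type is an ancestor set lies in a body member whenever it lies in a member of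
higher rank, so body members contain all later ones. Two legs share no edge, since an ancestor set
contains at most one leg. -/
lemma IsSpiderType.isLaminar {β : Type*} {t : ℕ} {r : Fin k → ℕ} (hr : Function.Injective r)
    (A : Fin k → Set β) (h : ∀ e, IsSpiderType t r {i | e ∈ A i}) :
    IsLaminar (Set.range A) := by
  have key : ∀ i j, r i < t → r i ≤ r j → A j ⊆ A i := by
    intro i j hi hij e he
    rcases h e with h0 | ⟨y, hy⟩
    · exact absurd he (Set.eq_empty_iff_forall_notMem.1 h0 j)
    · rcases hij.eq_or_lt with heq | hlt
      · rw [hr heq]; exact he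
      · refine (hy i).2 ?_
        rcases (hy j).1 he with rfl | ⟨-, h2⟩
        · exact Or.inr ⟨hi, hlt⟩
        · exact Or.inr ⟨hi, hlt.trans h2⟩
  rintro _ ⟨i, rfl⟩ _ ⟨j, rfl⟩
  by_cases hi : r i < t
  · rcases le_total (r i) (r j) with hij | hij
    · exact Or.inr (Or.inl (key i j hi hij))
    · exact Or.inl (key j i (hij.trans_lt hi) hij)
  · by_cases hj : r j < t
    · exact Or.inl (key j i hj (by omega))
    · rcases eq_or_ne i j with rfl | hij
      · exact Or.inl subset_rfl
      · refine Or.inr (Or.inr (Set.disjoint_left.2 fun e hei hej => ?_))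
        rcases h e with h0 | ⟨y, hy⟩
        · exact absurd hei (Set.eq_empty_iff_forall_notMem.1 h0 i)
        · have h1 := (hy i).1 hei
          have h2 := (hy j).1 hej
          simp only [hi, hj, false_and, or_false] at h1 h2
          exact hij (h1.trans h2.symm)

end Spiders

/-! ### The laminar cover of an arbitrary instance. -/

namespace SAPInstance

open scoped Nat

variable {α β : Type*} {k : ℕ}

/-- The bitmask of the set of subgraphs that contain an edge. -/
noncomputable def typeMask (I : SAPInstance α β k) (e : β) : ℕ :=
  bitmask {i : Fin k | e ∈ E(I.H i)}

/-- The optimal laminar cover. -/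
def spiderCover (I : SAPInstance α β k) (k' : ℕ) : Fin (coverList k k').length → Set β :=
  fun i => {e ∈ E(I.G) |
    IsSpiderMask k ((coverList k k').get i).1 ((coverList k k').get i).2 (I.typeMask e)}

lemma isLaminarCover_spiderCover (I : SAPInstance α β k) {k' : ℕ} (hk' : 1 ≤ k') (hk : k' ≤ k)
    (hI : I.EdgesInAtMost k') :
    I.IsLaminarCover (coverList k k').length (k ! * k !) (I.spiderCover k') := by
  refine ⟨⟨fun i e he => he.1, fun e he => ?_⟩, fun i => ?_⟩
  · refine (factorial_mul_factorial_le_countP hk' hk _ (hI e he)).trans (le_of_eq ?_)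
    rw [← ncard_getElem]
    congr 1
    ext i
    simp [spiderCover, he, typeMask]
  · have hmem := (coverList k k').get_mem i
    obtain ⟨t, ht, s, hs, c, hc, heq⟩ : ∃ t ∈ List.range k', ∃ s ∈ List.range
        (spiderWeight k k' t), ∃ c ∈ injectiveCodes k, (t, c) = (coverList k k').get i := by
      simpa only [coverList, List.mem_flatMap, List.mem_map] using hmem
    refine IsSpiderType.isLaminar (codeRank_injective hc) (t := t) _ fun e => ?_
    by_cases he : e ∈ I.spiderCover k' i
    · have h := he.2
      rw [← heq, typeMask, isSpiderMask_bitmask] at h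
      simpa [he] using h
    -- An edge outside this member of the cover has empty type after the restriction.
    · left
      simp [he]

end SAPInstance

/-! ### The extremal instance and the exact value of the least ratio. -/

section LowerBound

/-- If the stars of a family of sets of size greater than `j` are laminar, then the family has
at most `k - j` members. -/
lemma card_le_of_laminar_stars {k j : ℕ} (𝒯 : Finset (Finset (Fin k)))
    (hj : ∀ T ∈ 𝒯, j < T.card)
    (hlam : ∀ x y, 𝒯.filter (x ∈ ·) ⊆ 𝒯.filter (y ∈ ·) ∨
      𝒯.filter (y ∈ ·) ⊆ 𝒯.filter (x ∈ ·) ∨ Disjoint (𝒯.filter (x ∈ ·)) (𝒯.filter (y ∈ ·))) :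
    𝒯.card ≤ k - j := by
  rcases 𝒯.eq_empty_or_nonempty with rfl | hne
  · simp
  have : Nonempty (Fin k) := by
    obtain ⟨T, hT⟩ := hne
    obtain ⟨x, -⟩ := Finset.card_pos.1 ((Nat.zero_le j).trans_lt (hj T hT))
    exact ⟨x⟩
  -- The stars of the elements of `T` all contain `T`, so laminarity makes them a chain; an element
  -- with the smallest star represents `T`.
  have hrep : ∀ T ∈ 𝒯, ∃ x ∈ T, ∀ y, y ∈ T ↔ 𝒯.filter (x ∈ ·) ⊆ 𝒯.filter (y ∈ ·) := by
    intro T hT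
    obtain ⟨x, hx, hmin⟩ := T.exists_min_image (fun x => (𝒯.filter (x ∈ ·)).card)
      (Finset.card_pos.1 ((Nat.zero_le j).trans_lt (hj T hT)))
    refine ⟨x, hx, fun y => ⟨fun hy => ?_, fun h => ?_⟩⟩
    · rcases hlam x y with h | h | h
      · exact h
      · exact (Finset.eq_of_subset_of_card_le h (hmin y hy)).symm.subset
      · exact absurd (Finset.mem_filter.2 ⟨hT, hy⟩)
          (Finset.disjoint_left.1 h (Finset.mem_filter.2 ⟨hT, hx⟩))
    · exact (Finset.mem_filter.1 (h (Finset.mem_filter.2 ⟨hT, hx⟩))).2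
  choose! r hrmem hr using hrep
  obtain ⟨T₀, hT₀, hmin⟩ := 𝒯.exists_min_image Finset.card hne
  -- A representative of `T` inside the smallest set `T₀` forces `T ⊆ T₀`, hence `T = T₀`.
  have hmaps : ∀ T ∈ 𝒯, r T ∈ (T₀.erase (r T₀))ᶜ := by
    intro T hT
    rw [Finset.mem_compl, Finset.mem_erase]
    rintro ⟨hne', hmem⟩
    have hsub : T ⊆ T₀ := fun y hy => (Finset.mem_filter.1
      ((hr T hT y).1 hy (Finset.mem_filter.2 ⟨hT₀, hmem⟩))).2
    exact hne' (by rw [Finset.eq_of_subset_of_card_le hsub (hmin T hT)])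
  have hinj : Set.InjOn r (𝒯 : Set (Finset (Fin k))) := by
    intro T hT T' hT' h
    ext y
    rw [hr T hT, hr T' hT', h]
  have h1 := Finset.card_le_card_of_injOn r hmaps hinj
  rw [Finset.card_compl, Fintype.card_fin, Finset.card_erase_of_mem (hrmem T₀ hT₀)] at h1
  have := hj T₀ hT₀
  omega

/-- The instance with two nodes and one edge for each possible type. -/
def allTypesInstance (k k' : ℕ) (hk' : 1 ≤ k') :
    SAPInstance (ULift.{u} Bool) (ULift.{v} (Finset (Fin k))) k where
  G := Graph.banana ⟨false⟩ ⟨true⟩ {e | e.down.card ≤ k'}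
  finite_vertexSet := Set.toFinite _
  finite_edgeSet := Set.toFinite _
  loopless := ⟨fun e x h => by
    have h' := ((Graph.banana_isLink _ _ _ _ _ _).mp h).2
    rcases h' with ⟨h1, h2⟩ | ⟨h1, h2⟩ <;> simp [h1] at h2⟩
  c := 0
  H i := Graph.banana ⟨false⟩ ⟨true⟩ {e | e.down.card ≤ k' ∧ i ∈ e.down}
  H_le i := ⟨subset_rfl, fun e x y h => by
    rw [Graph.banana_isLink] at h ⊢
    exact ⟨h.1.1, h.2⟩⟩
  H_injective i j h := by
    -- The edge of type `{i}`, present because `1 ≤ k'`, tells the subgraphs apart.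
    have h1 : (⟨{i}⟩ : ULift (Finset (Fin k))) ∈
        {e : ULift.{v} (Finset (Fin k)) | e.down.card ≤ k' ∧ i ∈ e.down} := by
      simpa using hk'
    have h2 := congrArg Graph.edgeSet h
    simp only [Graph.edgeSet_banana] at h2
    rw [h2] at h1
    exact (Finset.mem_singleton.1 h1.2).symm
  b _ := 0
  L := ∅
  L_subset X hX := absurd hX (Set.notMem_empty X)
  L_laminar X hX := absurd hX (Set.notMem_empty X)
  g := 0
  w := 0

variable {k k' : ℕ}

lemma allTypesInstance_edgesInAtMost (hk' : 1 ≤ k') :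
    (allTypesInstance.{u, v} k k' hk').EdgesInAtMost k' := by
  intro e he
  refine le_trans (le_of_eq ?_) (show e.down.card ≤ k' from he)
  rw [← Set.ncard_coe_finset]
  congr 1
  ext i
  exact ⟨fun h => h.2, fun h => ⟨he, h⟩⟩

lemma allTypesInstance_exists_inc (hk' : 1 ≤ k') (i : Fin k)
    (z : ULift.{u} Bool) (hz : z ∈ V((allTypesInstance.{u, v} k k' hk').H i)) :
    ∃ e, ((allTypesInstance.{u, v} k k' hk').H i).Inc e z := by
  refine ⟨⟨{i}⟩, Graph.banana_inc.2 ⟨?_, hz⟩⟩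
  simpa using hk'

/-- Double counting of the pairs of a type of size in `(j, k']` and a cover member containing its
edge: each type occurs at least `l` times, each member holds at most `k - j` types. -/
lemma mul_levelSum_le_of_isLaminarCover (hk' : 1 ≤ k') {m l : ℕ}
    {F : Fin m → Set (ULift.{v} (Finset (Fin k)))}
    (hF : (allTypesInstance.{u, v} k k' hk').IsLaminarCover m l F) (j : ℕ) :
    l * levelSum k k' j ≤ m * (k - j) := by
  classical
  set 𝒰 : Finset (Finset (Fin k)) := {T | T.card ∈ Finset.Icc (j + 1) k'} with h𝒰
  have hcard : 𝒰.card = levelSum k k' j := by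
    rw [levelSum, h𝒰, Finset.card_eq_sum_card_fiberwise (f := Finset.card)
      (t := Finset.Icc (j + 1) k') (fun T hT => by simpa using hT)]
    refine Finset.sum_congr rfl fun i hi => ?_
    rw [show k.choose i = (Finset.powersetCard i (Finset.univ : Finset (Fin k))).card by simp,
      Finset.filter_filter]
    congr 1
    ext T
    simp only [Finset.mem_filter, Finset.mem_univ, true_and, Finset.mem_powersetCard,
      Finset.subset_univ]
    exact ⟨fun h => h.2, fun h => ⟨h ▸ hi, h⟩⟩
  calc l * levelSum k k' j = ∑ T ∈ 𝒰, l := by rw [Finset.sum_const, hcard, smul_eq_mul, mul_comm]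
    _ ≤ ∑ T ∈ 𝒰, (Finset.univ.filter fun i : Fin m => (⟨T⟩ : ULift _) ∈ F i).card := by
        refine Finset.sum_le_sum fun T hT => ?_
        have hT' : T.card ≤ k' := (Finset.mem_Icc.1 (Finset.mem_filter.1 hT).2).2
        refine (hF.1.2 ⟨T⟩ hT').trans (le_of_eq ?_)
        rw [Set.ncard_eq_toFinset_card', Set.toFinset_ofPred]
    _ = ∑ i : Fin m, (𝒰.filter fun T => (⟨T⟩ : ULift _) ∈ F i).card :=
        Finset.sum_card_bipartiteAbove_eq_sum_card_bipartiteBelow _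
    _ ≤ ∑ _i : Fin m, (k - j) := by
        refine Finset.sum_le_sum fun i _ => ?_
        refine card_le_of_laminar_stars _ (fun T hT => ?_) fun x y => ?_
        · exact (Finset.mem_Icc.1 (Finset.mem_filter.1 (Finset.mem_filter.1 hT).1).2).1
        · have hmem : ∀ x, ∀ T ∈ 𝒰.filter (fun T => (⟨T⟩ : ULift _) ∈ F i), x ∈ T ↔
              (⟨T⟩ : ULift _) ∈
                E(((allTypesInstance.{u, v} k k' hk').H x).restrict (F i)) := by
            intro x T hT
            obtain ⟨hT1, hT2⟩ := Finset.mem_filter.1 hT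
            have hT' : T.card ≤ k' := (Finset.mem_Icc.1 (Finset.mem_filter.1 hT1).2).2
            rw [Graph.edgeSet_restrict]
            exact ⟨fun h => ⟨⟨hT', h⟩, hT2⟩, fun h => h.1.2⟩
          rcases hF.2 i _ ⟨x, rfl⟩ _ ⟨y, rfl⟩ with h | h | h
          · left
            intro T hT
            obtain ⟨hT1, hT2⟩ := Finset.mem_filter.1 hT
            exact Finset.mem_filter.2 ⟨hT1, (hmem y T hT1).2 (h ((hmem x T hT1).1 hT2))⟩
          · right; left
            intro T hT
            obtain ⟨hT1, hT2⟩ := Finset.mem_filter.1 hT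
            exact Finset.mem_filter.2 ⟨hT1, (hmem x T hT1).2 (h ((hmem y T hT1).1 hT2))⟩
          · right; right
            refine Finset.disjoint_left.2 fun T hT hT' => ?_
            obtain ⟨hT1, hT2⟩ := Finset.mem_filter.1 hT
            exact Set.disjoint_left.1 h ((hmem x T hT1).1 hT2)
              ((hmem y T hT1).1 (Finset.mem_filter.1 hT').2)
    _ = m * (k - j) := by simp

lemma laminarCoverValue_le_of_isLaminarCover (hk' : 1 ≤ k') (hk : k' ≤ k) {m l : ℕ}
    {F : Fin m → Set (ULift.{v} (Finset (Fin k)))} (hl : 0 < l)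
    (hF : (allTypesInstance.{u, v} k k' hk').IsLaminarCover m l F) :
    laminarCoverValue k k' hk' ≤ (m : ℚ) / l := by
  refine Finset.sup'_le _ _ fun j hj => ?_
  have hjk : j < k := (Finset.mem_range.1 hj).trans_le hk
  have h := mul_levelSum_le_of_isLaminarCover hk' hF j
  have h' : (l : ℚ) * levelSum k k' j ≤ m * ((k : ℚ) - j) := by
    rw [← Nat.cast_sub hjk.le]; exact_mod_cast h
  have h0 : (0 : ℚ) < (k : ℚ) - j := sub_pos.2 (by exact_mod_cast hjk)
  rw [← Nat.cast_sum, ← levelSum, one_div_mul_eq_div, div_le_div_iff₀ h0 (by exact_mod_cast hl)]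
  linarith

lemma length_coverList_div_eq (hk' : 1 ≤ k') (hk : k' ≤ k) :
    ((coverList k k').length : ℚ) / (k.factorial * k.factorial : ℕ) =
      laminarCoverValue k k' hk' := by
  have h0 : (k.factorial : ℚ) ≠ 0 := by exact_mod_cast k.factorial_ne_zero
  rw [← sum_spiderWeight_div_eq hk' hk, length_coverList, Nat.cast_mul, Nat.cast_mul]
  field_simp

theorem isLeast_laminarCoverRatios (hk' : 1 ≤ k') (hk : k' ≤ k) :
    IsLeast (laminarCoverRatios.{u, v} k k') (laminarCoverValue k k' hk') := by
  refine ⟨⟨(coverList k k').length, k.factorial * k.factorial,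
    Nat.mul_pos k.factorial_pos k.factorial_pos, (length_coverList_div_eq hk' hk).symm,
    fun α β I hI => ⟨_, I.isLaminarCover_spiderCover hk' hk hI⟩⟩, ?_⟩
  rintro q ⟨m, l, hl, rfl, h⟩
  obtain ⟨F, hF⟩ := h _ _ (allTypesInstance.{u, v} k k' hk') (allTypesInstance_edgesInAtMost hk')
  exact laminarCoverValue_le_of_isLaminarCover hk' hk hl hF

end LowerBound

/-! ### Programs for primitive recursive functions. -/

namespace RAM

/-- `Reaches xs P s t s'`: from state `s`, the program `P` halts in state `s'` after at most
`t` steps. -/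
def Reaches (xs : List ℕ) (P : Prog) (s : State) (t : ℕ) (s' : State) : Prop :=
  ∃ t' ≤ t, Exec xs P s t' s'

namespace Reaches

variable {xs : List ℕ} {P Q : Prog} {s s' s'' : State} {t t' : ℕ} {a b : Expr} {r : ℕ}

lemma mono (h : Reaches xs P s t s') (ht : t ≤ t') : Reaches xs P s t' s' :=
  h.imp fun _ h => ⟨h.1.trans ht, h.2⟩

lemma skip : Reaches xs .skip s 1 s := ⟨1, le_rfl, .skip s⟩

lemma setReg : Reaches xs (.setReg r a) s (a.cost + 1)
    { s with reg := Function.update s.reg r (a.eval xs s) } := ⟨_, le_rfl, .setReg r a s⟩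

lemma output : Reaches xs (.output a) s (a.cost + 1) { s with out := s.out ++ [a.eval xs s] } :=
  ⟨_, le_rfl, .output a s⟩

lemma seq (h : Reaches xs P s t s') (h' : Reaches xs Q s' t' s'') :
    Reaches xs (.seq P Q) s (t + t') s'' := by
  obtain ⟨u, hu, h⟩ := h
  obtain ⟨u', hu', h'⟩ := h'
  exact ⟨u + u', add_le_add hu hu', .seq h h'⟩

lemma ite_true (ha : a.eval xs s ≠ 0) (h : Reaches xs P s t s') :
    Reaches xs (.ite a P Q) s (a.cost + 1 + t) s' := by
  obtain ⟨u, hu, h⟩ := h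
  exact ⟨_, Nat.add_le_add_left hu _, .ite_true ha h⟩

lemma ite_false (ha : a.eval xs s = 0) (h : Reaches xs Q s t s') :
    Reaches xs (.ite a P Q) s (a.cost + 1 + t) s' := by
  obtain ⟨u, hu, h⟩ := h
  exact ⟨_, Nat.add_le_add_left hu _, .ite_false ha h⟩

/-- A loop that runs `n` times, with an invariant. -/
lemma loop (Inv : ℕ → State → Prop) (n B : ℕ)
    (hstep : ∀ i < n, ∀ s, Inv i s → a.eval xs s ≠ 0 ∧ ∃ s', Reaches xs P s B s' ∧ Inv (i + 1) s')
    (hend : ∀ s, Inv n s → a.eval xs s = 0) (hs : Inv 0 s) :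
    ∃ s', Reaches xs (.loop a P) s ((n + 1) * (a.cost + 1 + B)) s' ∧ Inv n s' := by
  have key : ∀ d i s, i + d = n → Inv i s →
      ∃ s', Reaches xs (.loop a P) s ((d + 1) * (a.cost + 1 + B)) s' ∧ Inv n s' := by
    intro d
    induction d with
    | zero =>
      intro i s hi hs
      obtain rfl : i = n := by omega
      exact ⟨s, ⟨_, by omega, .loop_false (hend s hs)⟩, hs⟩
    | succ d ih =>
      intro i s hi hs
      obtain ⟨h0, s1, ⟨t1, ht1, h1⟩, hi1⟩ := hstep i (by omega) s hs
      obtain ⟨s2, ⟨t2, ht2, h2⟩, hi2⟩ := ih (i + 1) s1 (by omega) hi1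
      refine ⟨s2, ⟨_, ?_, .loop_true h0 h1 h2⟩, hi2⟩
      rw [Nat.succ_mul (d + 1)]
      omega
  exact key n 0 s (by omega) hs

end Reaches

/-- The program `P` computes `f` on the registers `args` into the register `dst`, without
changing any other register below `N`, in time depending only on the arguments. -/
def Computes {n : ℕ} (P : Prog) (f : List.Vector ℕ n → ℕ) (args : Fin n → ℕ) (dst N : ℕ) : Prop :=
  ∀ v : List.Vector ℕ n, ∃ t, ∀ xs s, (∀ i, s.reg (args i) = v.get i) →
    ∃ s', Reaches xs P s t s' ∧ s'.mem = s.mem ∧ s'.out = s.out ∧ s'.reg dst = f v ∧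
      ∀ r < N, r ≠ dst → s'.reg r = s.reg r

/-- Every primitive recursive function is computed by a program. -/
theorem exists_computes {n : ℕ} {f : List.Vector ℕ n → ℕ} (hf : Nat.Primrec' f) :
    ∀ (args : Fin n → ℕ) (dst N : ℕ), (∀ i, args i < N) → dst < N →
      ∃ P, Computes P f args dst N := by
  induction hf with
  | zero =>
    intro args dst N hargs hdst
    refine ⟨.setReg dst (.lit 0), fun v => ⟨2, fun xs s hs => ⟨_, Reaches.setReg, rfl, rfl, ?_, ?_⟩⟩⟩
    · simp [Expr.eval]
    · intro r hr hne
      simp [hne]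
  | succ =>
    intro args dst N hargs hdst
    refine ⟨.setReg dst (.plus (.reg (args 0)) (.lit 1)), fun v =>
      ⟨4, fun xs s hs => ⟨_, Reaches.setReg, rfl, rfl, ?_, ?_⟩⟩⟩
    · simp [Expr.eval, hs 0]
    · intro r hr hne
      simp [hne]
  | get i =>
    intro args dst N hargs hdst
    refine ⟨.setReg dst (.reg (args i)), fun v =>
      ⟨2, fun xs s hs => ⟨_, Reaches.setReg, rfl, rfl, ?_, ?_⟩⟩⟩
    · simp [Expr.eval, hs i]
    · intro r hr hne
      simp [hne]
  | @comp n m f g hf hg ihf ihg =>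
    intro args dst N hargs hdst
    -- The inner values go to registers `N, ..., N + m - 1`; each inner program protects everything
    -- below `N + m`, so it spoils neither the arguments nor earlier values.
    have hpre : ∀ j ≤ m, ∃ P : Prog, ∀ v : List.Vector ℕ n, ∃ t, ∀ xs s,
        (∀ i, s.reg (args i) = v.get i) →
        ∃ s', Reaches xs P s t s' ∧ s'.mem = s.mem ∧ s'.out = s.out ∧
          (∀ i : Fin m, (i : ℕ) < j → s'.reg (N + i) = g i v) ∧
          ∀ r < N, s'.reg r = s.reg r := by
      intro j
      induction j with
      | zero =>
        intro _
        exact ⟨.skip, fun v => ⟨1, fun xs s hs => ⟨s, Reaches.skip, rfl, rfl,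
          fun i hi => absurd hi (Nat.not_lt_zero _), fun _ _ => rfl⟩⟩⟩
      | succ j ih =>
        intro hj
        obtain ⟨P, hP⟩ := ih (by omega)
        obtain ⟨Q, hQ⟩ := ihg ⟨j, hj⟩ args (N + j) (N + m)
          (fun i => (hargs i).trans_le (Nat.le_add_right _ _)) (by omega)
        refine ⟨.seq P Q, fun v => ?_⟩
        obtain ⟨t1, h1⟩ := hP v
        obtain ⟨t2, h2⟩ := hQ v
        refine ⟨t1 + t2, fun xs s hs => ?_⟩
        obtain ⟨s1, hr1, hm1, ho1, hv1, hk1⟩ := h1 xs s hs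
        obtain ⟨s2, hr2, hm2, ho2, hv2, hk2⟩ := h2 xs s1
          (fun i => by rw [hk1 _ (hargs i), hs i])
        refine ⟨s2, hr1.seq hr2, hm2.trans hm1, ho2.trans ho1, fun i hi => ?_, fun r hr => ?_⟩
        · rcases (Nat.lt_succ_iff_lt_or_eq.1 hi) with hi | hi
          · rw [hk2 _ (by omega) (by omega), hv1 i hi]
          · obtain rfl : i = ⟨j, hj⟩ := Fin.ext hi
            exact hv2
        · rw [hk2 r (by omega) (by omega), hk1 r hr]
    obtain ⟨P, hP⟩ := hpre m le_rfl
    obtain ⟨Q, hQ⟩ := ihf (fun i => N + i) dst (N + m) (fun i => by omega) (by omega)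
    refine ⟨.seq P Q, fun v => ?_⟩
    obtain ⟨t1, h1⟩ := hP v
    obtain ⟨t2, h2⟩ := hQ (List.Vector.ofFn fun i => g i v)
    refine ⟨t1 + t2, fun xs s hs => ?_⟩
    obtain ⟨s1, hr1, hm1, ho1, hv1, hk1⟩ := h1 xs s hs
    obtain ⟨s2, hr2, hm2, ho2, hv2, hk2⟩ := h2 xs s1
      (fun i => by rw [List.Vector.get_ofFn]; exact hv1 i i.2)
    exact ⟨s2, hr1.seq hr2, hm2.trans hm1, ho2.trans ho1, hv2, fun r hr hne => by
      rw [hk2 r (by omega) hne, hk1 r hr]⟩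
  | @prec n f g hf hg ihf ihg =>
    intro args dst N hargs hdst
    -- Register `N` accumulates the value, `N + 1` holds the recursion index and `N + 2` the number
    -- of rounds left.
    obtain ⟨P, hP⟩ := ihf (fun i => args i.succ) N (N + 3)
      (fun i => (hargs _).trans_le (Nat.le_add_right _ _)) (by omega)
    obtain ⟨Q, hQ⟩ := ihg (Fin.cons (N + 1) (Fin.cons N fun i => args i.succ)) N (N + 3)
      (fun i => by
        refine Fin.cases (by simp) (fun i => ?_) i
        refine Fin.cases (by simp) (fun i => ?_) i
        simpa using (hargs _).trans_le (Nat.le_add_right _ _)) (by omega)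
    refine ⟨.seq P (.seq (.setReg (N + 1) (.lit 0)) (.seq (.setReg (N + 2) (.reg (args 0)))
      (.seq (.loop (.reg (N + 2)) (.seq Q (.seq
        (.setReg (N + 1) (.plus (.reg (N + 1)) (.lit 1)))
        (.setReg (N + 2) (.minus (.reg (N + 2)) (.lit 1))))))
      (.setReg dst (.reg N))))), fun v => ?_⟩
    obtain ⟨t1, h1⟩ := hP v.tail
    let F : ℕ → ℕ := fun j => j.rec (f v.tail) fun y IH => g (y ::ᵥ IH ::ᵥ v.tail)
    choose t2 h2 using fun y => hQ (y ::ᵥ F y ::ᵥ v.tail)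
    -- The sum of the `t2 y` bounds every single round and depends on `v` only, as the time bound
    -- must.
    refine ⟨t1 + (2 + (2 + ((v.head + 1) *
      (2 + ((∑ y ∈ Finset.range v.head, t2 y) + (4 + 4))) + 2))), fun xs s hs => ?_⟩
    obtain ⟨s1, hr1, hm1, ho1, hv1, hk1⟩ := h1 xs s (fun i => by rw [hs, List.Vector.get_tail_succ])
    let s2 : State :=
      ⟨Function.update (Function.update s1.reg (N + 1) 0) (N + 2) (s1.reg (args 0)), s1.mem, s1.out⟩
    let Inv : ℕ → State → Prop := fun j s' => s'.mem = s.mem ∧ s'.out = s.out ∧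
      s'.reg N = F j ∧ s'.reg (N + 1) = j ∧ s'.reg (N + 2) = v.head - j ∧
      ∀ r < N, s'.reg r = s.reg r
    have hne : ∀ r < N, r ≠ N ∧ r ≠ N + 1 ∧ r ≠ N + 2 := fun r hr => by omega
    have hargs0 : s1.reg (args 0) = v.head := by
      rw [hk1 _ (by have := hargs 0; omega) (hargs 0).ne, hs, List.Vector.get_zero]
    obtain ⟨s3, hr3, hm3, ho3, hv3, -, -, hk3⟩ := Reaches.loop (xs := xs) (a := .reg (N + 2))
      (P := .seq Q (.seq (.setReg (N + 1) (.plus (.reg (N + 1)) (.lit 1)))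
        (.setReg (N + 2) (.minus (.reg (N + 2)) (.lit 1))))) (s := s2) Inv v.head
      ((∑ y ∈ Finset.range v.head, t2 y) + (4 + 4))
      (fun j hj s' ⟨hm, ho, hF, hy, hc, hk⟩ => by
        refine ⟨by simp only [Expr.eval, hc]; omega, ?_⟩
        obtain ⟨s4, hr4, hm4, ho4, hv4, hk4⟩ := h2 j xs s' (fun i => by
          refine Fin.cases ?_ (fun i => ?_) i
          · simpa using hy
          refine Fin.cases ?_ (fun i => ?_) i
          · exact hF
          · simp only [Fin.cons_succ, List.Vector.get_cons_succ, List.Vector.get_tail_succ]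
            rw [hk _ (hargs _), hs])
        refine ⟨_, (hr4.seq (Reaches.setReg.seq Reaches.setReg)).mono
          (Nat.add_le_add_right (Finset.single_le_sum (f := t2) (fun _ _ => Nat.zero_le _)
            (Finset.mem_range.2 hj)) _), hm4.trans hm, ho4.trans ho, ?_, ?_, ?_, ?_⟩
        · simpa using hv4
        · simpa [Expr.eval, hy] using hk4 (N + 1) (by omega) (by omega)
        · have := hk4 (N + 2) (by omega) (by omega)
          simp [Expr.eval, this, hc]
          omega
        · intro r hr
          obtain ⟨h1, h2, h3⟩ := hne r hr
          simp only [Function.update_of_ne h2, Function.update_of_ne h3]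
          rw [hk4 r (by omega) h1, hk r hr])
      (fun s' hs' => by simp [Expr.eval, hs'.2.2.2.2.1])
      ⟨hm1, ho1, by simpa [s2, F] using hv1, by simp [s2], by simpa [s2] using hargs0,
        fun r hr => by
          obtain ⟨h1, h2, h3⟩ := hne r hr
          simp only [s2, Function.update_of_ne h2, Function.update_of_ne h3]
          exact hk1 r (by omega) h1⟩
    have hs2 : ∀ s₀ : State, s₀ = { s1 with reg := Function.update s1.reg (N + 1) 0 } →
        Reaches xs (.setReg (N + 2) (.reg (args 0))) s₀ 2 s2 := by
      rintro _ rfl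
      have := Reaches.setReg (xs := xs) (r := N + 2) (a := .reg (args 0))
        (s := { s1 with reg := Function.update s1.reg (N + 1) 0 })
      simpa [Expr.eval, Expr.cost, s2, Function.update_of_ne (hne _ (hargs 0)).2.1] using this
    refine ⟨_, hr1.seq (Reaches.setReg.seq ((hs2 _ rfl).seq (hr3.seq Reaches.setReg))),
      hm3, ho3, ?_, ?_⟩
    · simp only [Expr.eval, Function.update_self, hv3, F]
    · intro r hr hne'
      simp only [Function.update_of_ne hne']
      exact hk3 r hr

end RAM

/-! ### Primitive recursiveness of the cover data. -/

section Primrec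

open scoped Nat

/-- The bit written for an edge with bitmask `T` and the `i`-th spider of the cover. -/
def coverBit (k k' i T : ℕ) : ℕ :=
  if IsSpiderMask k ((coverList k k').getD i (0, 0)).1 ((coverList k k').getD i (0, 0)).2 T
  then 1 else 0

variable {α : Type*} [Primcodable α]

lemma Primrec.nat_pow : Primrec₂ ((· ^ ·) : ℕ → ℕ → ℕ) := by
  refine Primrec₂.unpaired'.1 (Nat.Primrec.pow.of_eq fun n => ?_)
  rfl

lemma Primrec.nat_factorial : Primrec Nat.factorial := by
  refine (Primrec.nat_rec₁ (f := fun n IH => (n + 1) * IH) 1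
    (Primrec.nat_mul.comp (Primrec.succ.comp Primrec.fst) Primrec.snd)).of_eq fun n => ?_
  induction n with
  | zero => rfl
  | succ n ih => simp [Nat.factorial_succ, ← ih]

lemma Primrec.nat_choose : Primrec₂ Nat.choose := by
  have h : Primrec fun p : ℕ × ℕ =>
      if p.2 ≤ p.1 then p.1 ! / (p.2 ! * (p.1 - p.2)!) else 0 :=
    Primrec.ite (Primrec.nat_le.comp Primrec.snd Primrec.fst)
      (Primrec.nat_div.comp (Primrec.nat_factorial.comp Primrec.fst)
        (Primrec.nat_mul.comp (Primrec.nat_factorial.comp Primrec.snd)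
          (Primrec.nat_factorial.comp (Primrec.nat_sub.comp Primrec.fst Primrec.snd))))
      (Primrec.const 0)
  refine h.of_eq fun p => ?_
  split_ifs with hp
  · exact (Nat.choose_eq_factorial_div_factorial hp).symm
  · exact (Nat.choose_eq_zero_of_lt (not_le.1 hp)).symm

lemma Primrec.sum_range {n : α → ℕ} {f : α → ℕ → ℕ} (hn : Primrec n) (hf : Primrec₂ f) :
    Primrec fun a => ∑ i ∈ Finset.range (n a), f a i := by
  refine (Primrec.nat_rec' hn (Primrec.const 0) (h := fun a p => p.2 + f a p.1)
    (Primrec.nat_add.comp (Primrec.snd.comp Primrec.snd)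
      (hf.comp Primrec.fst (Primrec.fst.comp Primrec.snd)))).of_eq fun a => ?_
  induction n a with
  | zero => rfl
  | succ n ih => rw [Finset.sum_range_succ, ← ih]

lemma primrec_codeRank : Primrec fun p : ℕ × ℕ × ℕ => codeRank p.1 p.2.1 p.2.2 :=
  Primrec.nat_mod.comp (Primrec.nat_div.comp (Primrec.fst.comp Primrec.snd)
    (Primrec.nat_pow.comp Primrec.fst (Primrec.snd.comp Primrec.snd))) Primrec.fst

lemma primrec_levelSum : Primrec fun p : ℕ × ℕ × ℕ => levelSum p.1 p.2.1 p.2.2 := by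
  have h : Primrec fun p : ℕ × ℕ × ℕ =>
      ∑ i ∈ Finset.range (p.2.1 - p.2.2), p.1.choose (i + (p.2.2 + 1)) :=
    Primrec.sum_range
      (Primrec.nat_sub.comp (Primrec.fst.comp Primrec.snd) (Primrec.snd.comp Primrec.snd))
      (Primrec.nat_choose.comp (Primrec.fst.comp Primrec.fst)
        (Primrec.nat_add.comp Primrec.snd
          (Primrec.succ.comp (Primrec.snd.comp (Primrec.snd.comp Primrec.fst)))))
  refine h.of_eq fun p => ?_
  rw [levelSum, ← Finset.Ico_add_one_right_eq_Icc, Finset.sum_Ico_eq_sum_range]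
  simp only [Nat.reduceSubDiff, add_comm]

lemma primrec_scaledRatio : Primrec fun p : ℕ × ℕ × ℕ => scaledRatio p.1 p.2.1 p.2.2 :=
  Primrec.nat_mul.comp primrec_levelSum
    (Primrec.nat_div.comp (Primrec.nat_factorial.comp Primrec.fst)
      (Primrec.nat_sub.comp Primrec.fst (Primrec.snd.comp Primrec.snd)))

lemma primrec_spiderWeight : Primrec fun p : ℕ × ℕ × ℕ => spiderWeight p.1 p.2.1 p.2.2 :=
  Primrec.nat_sub.comp primrec_scaledRatio
    (primrec_scaledRatio.comp (Primrec.pair Primrec.fst (Primrec.pair (Primrec.fst.comp Primrec.snd)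
      (Primrec.succ.comp (Primrec.snd.comp Primrec.snd)))))

lemma PrimrecPred.forall_lt_of {p : α → ℕ → Prop} {n : α → ℕ} (hn : Primrec n)
    (hp : PrimrecPred fun q : α × ℕ => p q.1 q.2) : PrimrecPred fun a => ∀ x < n a, p a x := by
  have h : PrimrecRel fun (x : ℕ) (a : α) => p a x :=
    hp.comp (Primrec.pair Primrec.snd Primrec.fst)
  exact (h.forall_mem_list.comp (Primrec.list_range.comp hn) Primrec.id).of_eq (by simp)

lemma PrimrecPred.exists_lt_of {p : α → ℕ → Prop} {n : α → ℕ} (hn : Primrec n)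
    (hp : PrimrecPred fun q : α × ℕ => p q.1 q.2) : PrimrecPred fun a => ∃ x < n a, p a x := by
  have h : PrimrecRel fun (x : ℕ) (a : α) => p a x :=
    hp.comp (Primrec.pair Primrec.snd Primrec.fst)
  exact (h.exists_mem_list.comp (Primrec.list_range.comp hn) Primrec.id).of_eq (by simp)

lemma PrimrecPred.imp_of {p q : α → Prop} (hp : PrimrecPred p) (hq : PrimrecPred q) :
    PrimrecPred fun a => p a → q a :=
  (hp.not.or hq).of_eq fun _ => imp_iff_not_or.symm

lemma PrimrecPred.iff_of {p q : α → Prop} (hp : PrimrecPred p) (hq : PrimrecPred q) :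
    PrimrecPred fun a => (p a ↔ q a) :=
  ((hp.imp_of hq).and (hq.imp_of hp)).of_eq fun _ => iff_iff_implies_and_implies.symm

lemma Primrec.codeRank_comp {f g h : α → ℕ} (hf : Primrec f) (hg : Primrec g) (hh : Primrec h) :
    Primrec fun a => codeRank (f a) (g a) (h a) :=
  primrec_codeRank.comp (Primrec.pair hf (Primrec.pair hg hh))

lemma primrec_injectiveCodes : Primrec injectiveCodes := by
  have hp : PrimrecPred fun q : ℕ × ℕ => ∀ x < q.1, ∀ y < q.1,
      codeRank q.1 q.2 x = codeRank q.1 q.2 y → x = y := by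
    refine PrimrecPred.forall_lt_of Primrec.fst (PrimrecPred.forall_lt_of
      (Primrec.fst.comp Primrec.fst) (PrimrecPred.imp_of (Primrec.eq.comp ?_ ?_)
        (Primrec.eq.comp (Primrec.snd.comp Primrec.fst) Primrec.snd)))
    · exact Primrec.codeRank_comp (Primrec.fst.comp (Primrec.fst.comp Primrec.fst))
        (Primrec.snd.comp (Primrec.fst.comp Primrec.fst)) (Primrec.snd.comp Primrec.fst)
    · exact Primrec.codeRank_comp (Primrec.fst.comp (Primrec.fst.comp Primrec.fst))
        (Primrec.snd.comp (Primrec.fst.comp Primrec.fst)) Primrec.snd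
  -- The filter is rewritten as a `flatMap` into lists of length at most one.
  have h : Primrec fun k : ℕ => (List.range (k ^ k)).flatMap fun c =>
      if (∀ x < k, ∀ y < k, codeRank k c x = codeRank k c y → x = y) then [c] else [] :=
    Primrec.list_flatMap (Primrec.list_range.comp (Primrec.nat_pow.comp Primrec.id Primrec.id))
      (Primrec.ite hp (Primrec.list_cons.comp Primrec.snd (Primrec.const [])) (Primrec.const []))
  refine h.of_eq fun k => ?_
  rw [injectiveCodes]
  induction List.range (k ^ k) with
  | nil => rfl
  | cons c l ih =>
    rw [List.flatMap_cons, ih, List.filter_cons]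
    simp only [decide_eq_true_iff]
    split_ifs <;> rfl

lemma primrec_coverList : Primrec fun p : ℕ × ℕ => coverList p.1 p.2 := by
  refine Primrec.list_flatMap (Primrec.list_range.comp Primrec.snd) (Primrec.list_flatMap
    (Primrec.list_range.comp (primrec_spiderWeight.comp
      (Primrec.pair (Primrec.fst.comp Primrec.fst)
        (Primrec.pair (Primrec.snd.comp Primrec.fst) Primrec.snd)))) (Primrec.list_map ?_ ?_))
  · exact primrec_injectiveCodes.comp (Primrec.fst.comp (Primrec.fst.comp Primrec.fst))
  · exact Primrec.pair (Primrec.snd.comp (Primrec.fst.comp Primrec.fst)) Primrec.snd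

lemma primrecPred_isSpiderMask : PrimrecPred fun p : ℕ × ℕ × ℕ × ℕ =>
    IsSpiderMask p.1 p.2.1 p.2.2.1 p.2.2.2 := by
  have hk : Primrec fun p : ((ℕ × ℕ × ℕ × ℕ) × ℕ) × ℕ => p.1.1.1 :=
    Primrec.fst.comp (Primrec.fst.comp Primrec.fst)
  have ht : Primrec fun p : ((ℕ × ℕ × ℕ × ℕ) × ℕ) × ℕ => p.1.1.2.1 :=
    Primrec.fst.comp (Primrec.snd.comp (Primrec.fst.comp Primrec.fst))
  have hc : Primrec fun p : ((ℕ × ℕ × ℕ × ℕ) × ℕ) × ℕ => p.1.1.2.2.1 :=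
    Primrec.fst.comp (Primrec.snd.comp (Primrec.snd.comp (Primrec.fst.comp Primrec.fst)))
  have hT : Primrec fun p : ((ℕ × ℕ × ℕ × ℕ) × ℕ) × ℕ => p.1.1.2.2.2 :=
    Primrec.snd.comp (Primrec.snd.comp (Primrec.snd.comp (Primrec.fst.comp Primrec.fst)))
  have hy : Primrec fun p : ((ℕ × ℕ × ℕ × ℕ) × ℕ) × ℕ => p.1.2 := Primrec.snd.comp Primrec.fst
  have hx : Primrec fun p : ((ℕ × ℕ × ℕ × ℕ) × ℕ) × ℕ => p.2 := Primrec.snd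
  have hrx := Primrec.codeRank_comp hk hc hx
  have hry := Primrec.codeRank_comp hk hc hy
  refine (Primrec.eq.comp (Primrec.snd.comp (Primrec.snd.comp Primrec.snd))
    (Primrec.const 0)).or (PrimrecPred.exists_lt_of Primrec.fst
      (PrimrecPred.forall_lt_of (Primrec.fst.comp Primrec.fst) (PrimrecPred.iff_of ?_ ?_)))
  · exact Primrec.eq.comp (Primrec.nat_mod.comp (Primrec.nat_div.comp hT
      (Primrec.nat_pow.comp (Primrec.const 2) hx)) (Primrec.const 2)) (Primrec.const 1)
  · exact (Primrec.eq.comp hx hy).or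
      ((Primrec.nat_lt.comp hrx ht).and (Primrec.nat_lt.comp hrx hry))

lemma primrec_coverBit : Primrec fun p : ℕ × ℕ × ℕ × ℕ =>
    coverBit p.1 p.2.1 p.2.2.1 p.2.2.2 := by
  have hs : Primrec fun p : ℕ × ℕ × ℕ × ℕ => (coverList p.1 p.2.1).getD p.2.2.1 (0, 0) :=
    (Primrec.list_getD (0, 0)).comp
      (primrec_coverList.comp (Primrec.pair Primrec.fst (Primrec.fst.comp Primrec.snd)))
      (Primrec.fst.comp (Primrec.snd.comp Primrec.snd))
  exact Primrec.ite (primrecPred_isSpiderMask.comp (Primrec.pair Primrec.fst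
    (Primrec.pair (Primrec.fst.comp hs) (Primrec.pair (Primrec.snd.comp hs)
      (Primrec.snd.comp (Primrec.snd.comp Primrec.snd))))))
    (Primrec.const 1) (Primrec.const 0)

lemma primrec'_length_coverList :
    Nat.Primrec' fun v : List.Vector ℕ 2 => (coverList (v.get 0) (v.get 1)).length :=
  Nat.Primrec'.of_prim (Primrec.list_length.comp (primrec_coverList.comp (Primrec.pair
    (Primrec.vector_get.comp Primrec.id (Primrec.const 0))
    (Primrec.vector_get.comp Primrec.id (Primrec.const 1)))))

lemma primrec'_factorial_mul_factorial :
    Nat.Primrec' fun v : List.Vector ℕ 1 => (v.get 0)! * (v.get 0)! :=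
  have h : Primrec fun v : List.Vector ℕ 1 => (v.get 0)! :=
    Primrec.nat_factorial.comp (Primrec.vector_get.comp Primrec.id (Primrec.const 0))
  Nat.Primrec'.of_prim (Primrec.nat_mul.comp h h)

lemma primrec'_coverBit : Nat.Primrec' fun v : List.Vector ℕ 4 =>
    coverBit (v.get 0) (v.get 1) (v.get 2) (v.get 3) :=
  Nat.Primrec'.of_prim (primrec_coverBit.comp (Primrec.pair
    (Primrec.vector_get.comp Primrec.id (Primrec.const 0)) (Primrec.pair
    (Primrec.vector_get.comp Primrec.id (Primrec.const 1)) (Primrec.pair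
    (Primrec.vector_get.comp Primrec.id (Primrec.const 2))
    (Primrec.vector_get.comp Primrec.id (Primrec.const 3))))))

end Primrec

/-! ### Reading types from the input and writing the cover. -/

section Encoding

lemma List.getD_flatten_ofFn {c d : ℕ} (hd : d < c) {k : ℕ} (L : Fin k → List ℕ)
    (hL : ∀ i, (L i).length = c) (i : Fin k) :
    (List.ofFn L).flatten.getD (i * c + d) 0 = (L i).getD d 0 := by
  induction k with
  | zero => exact i.elim0
  | succ k ih =>
    rw [List.ofFn_succ, List.flatten_cons]
    refine Fin.cases ?_ (fun i => ?_) i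
    · rw [List.getD_append _ _ _ _ (by simpa [hL] using hd)]
      simp
    · rw [List.getD_append_right _ _ _ _ (by rw [hL, Fin.val_succ, Nat.succ_mul]; omega), hL,
        ← ih (fun i => L i.succ) (fun i => hL _) i]
      congr 1
      rw [Fin.val_succ, Nat.succ_mul]
      omega

lemma List.map_range_eq_ofFn {γ : Type*} (f : ℕ → γ) (n : ℕ) :
    (List.range n).map f = List.ofFn fun i : Fin n => f i := by
  refine List.ext_getElem (by simp) fun i h1 h2 => by simp

variable {n q k : ℕ}

lemma length_bits {n : ℕ} (X : Set (Fin n)) : (bits X).length = n := by simp [bits]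

open Classical in
lemma getD_bits {n : ℕ} (X : Set (Fin n)) (a : Fin n) :
    (bits X).getD a 0 = if a ∈ X then 1 else 0 := by
  simp [bits, List.getD_eq_getElem?_getD]

variable (k' : ℕ) (I : SAPInstance (Fin n) (Fin q) k) (x y : Fin q → Fin n)

lemma encodeInstance_getD_zero : (encodeInstance k' I x y).getD 0 0 = k := rfl

lemma encodeInstance_getD_one : (encodeInstance k' I x y).getD 1 0 = k' := rfl

lemma encodeInstance_getD_two : (encodeInstance k' I x y).getD 2 0 = n := rfl

lemma encodeInstance_getD_three : (encodeInstance k' I x y).getD 3 0 = q := rfl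

-- The address skips four numbers, the `2q` edge ends, `i` blocks of length `n + q`, and the `n`
-- node bits of block `i`.
open Classical in
lemma encodeInstance_getD_edge (i : Fin k) (e : Fin q) :
    (encodeInstance k' I x y).getD (4 + (q + q) + n + e + i * (n + q)) 0 =
      if e ∈ E(I.H i) then 1 else 0 := by
  have hlen : ((List.ofFn fun a : Fin q => [(x a : ℕ), (y a : ℕ)]).flatten).length = q + q := by
    simp [List.length_flatten, List.map_ofFn, Function.comp_def]
    ring
  rw [encodeInstance, List.getD_append_right _ _ _ _ (by
    rw [List.length_append, hlen]; simp only [List.length_cons, List.length_nil]; omega),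
    List.length_append, hlen,
    show 4 + (q + q) + n + e + i * (n + q) - ([k, k', n, q].length + (q + q)) =
      i * (n + q) + (n + e) by simp only [List.length_cons, List.length_nil]; omega,
    List.getD_flatten_ofFn (by omega) _ (fun i => by simp [length_bits]),
    List.getD_append_right _ _ _ _ (by simp [length_bits]), length_bits, Nat.add_sub_cancel_left,
    getD_bits]

lemma typeMask_eq_sum (e : Fin q) :
    I.typeMask e = ∑ i ∈ Finset.range k,
      if (encodeInstance k' I x y).getD (4 + (q + q) + n + e + i * (n + q)) 0 = 0
        then 0 else 2 ^ i := by
  classical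
  rw [SAPInstance.typeMask, bitmask, ← Fin.sum_univ_eq_sum_range (fun i =>
    if (encodeInstance k' I x y).getD (4 + (q + q) + n + e + i * (n + q)) 0 = 0
      then 0 else 2 ^ i)]
  refine Finset.sum_congr rfl fun i _ => ?_
  rw [encodeInstance_getD_edge]
  by_cases h : e ∈ E(I.H i) <;> simp [h]

lemma encodeCover_spiderCover (hE : E(I.G) = Set.univ) (l : ℕ) :
    encodeCover (coverList k k').length l (I.spiderCover k') =
      [(coverList k k').length, l] ++ ((List.range (coverList k k').length).map fun i =>
        (List.range q).map fun e => coverBit k k' i (∑ i ∈ Finset.range k,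
          if (encodeInstance k' I x y).getD (4 + (q + q) + n + e + i * (n + q)) 0 = 0
            then 0 else 2 ^ i)).flatten := by
  rw [encodeCover, List.map_range_eq_ofFn]
  congr 3
  funext i
  rw [List.map_range_eq_ofFn, bits]
  congr 1
  funext e
  rw [← typeMask_eq_sum, coverBit]
  simp [SAPInstance.spiderCover, hE]

end Encoding

/-! ### The cover program and its running time. -/

namespace RAM

/-- Computes the bitmask of the edge in register `6` into register `3`. -/
def maskProg : Prog :=
  .seq (.setReg 3 (.lit 0)) (.seq (.setReg 7 (.lit 1)) (.seq
    (.setReg 8 (.plus (.plus (.plus (.lit 4) (.plus (.inp (.lit 3)) (.inp (.lit 3))))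
      (.inp (.lit 2))) (.reg 6))) (.seq (.setReg 9 (.reg 0))
    (.loop (.reg 9) (.seq
      (.ite (.inp (.reg 8)) (.setReg 3 (.plus (.reg 3) (.reg 7))) .skip) (.seq
      (.setReg 7 (.plus (.reg 7) (.reg 7))) (.seq
      (.setReg 8 (.plus (.reg 8) (.plus (.inp (.lit 2)) (.inp (.lit 3)))))
      (.setReg 9 (.minus (.reg 9) (.lit 1))))))))))

lemma maskProg_reaches (xs : List ℕ) (s : State) :
    ∃ s', Reaches xs maskProg s (20 + (s.reg 0 + 1) * 30) s' ∧ s'.out = s.out ∧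
      s'.reg 3 = (∑ i ∈ Finset.range (s.reg 0),
        if xs.getD (4 + (xs.getD 3 0 + xs.getD 3 0) + xs.getD 2 0 + s.reg 6 +
          i * (xs.getD 2 0 + xs.getD 3 0)) 0 = 0 then 0 else 2 ^ i) ∧
      ∀ r < 7, r ≠ 3 → s'.reg r = s.reg r := by
  set a := 4 + (xs.getD 3 0 + xs.getD 3 0) + xs.getD 2 0 + s.reg 6 with ha
  set c := xs.getD 2 0 + xs.getD 3 0 with hc
  -- Register `7` holds the current power of two, `8` the input address for the next subgraph and
  -- `9` the rounds left.
  let Inv : ℕ → State → Prop := fun j s' => s'.out = s.out ∧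
    s'.reg 3 = (∑ i ∈ Finset.range j, if xs.getD (a + i * c) 0 = 0 then 0 else 2 ^ i) ∧
    s'.reg 7 = 2 ^ j ∧ s'.reg 8 = a + j * c ∧ s'.reg 9 = s.reg 0 - j ∧
    ∀ r < 7, r ≠ 3 → s'.reg r = s.reg r
  have hstep : ∀ j < s.reg 0, ∀ s', Inv j s' → (Expr.reg 9).eval xs s' ≠ 0 ∧
      ∃ s'', Reaches xs (.seq
        (.ite (.inp (.reg 8)) (.setReg 3 (.plus (.reg 3) (.reg 7))) .skip) (.seq
        (.setReg 7 (.plus (.reg 7) (.reg 7))) (.seq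
        (.setReg 8 (.plus (.reg 8) (.plus (.inp (.lit 2)) (.inp (.lit 3)))))
        (.setReg 9 (.minus (.reg 9) (.lit 1)))))) s' 28 s'' ∧ Inv (j + 1) s'' := by
    rintro j hj s' ⟨h1, h2, h3, h4, h5, h6⟩
    refine ⟨by simp only [Expr.eval, h5]; omega, ?_⟩
    have hite : ∃ s₁, Reaches xs
        (.ite (.inp (.reg 8)) (.setReg 3 (.plus (.reg 3) (.reg 7))) .skip) s' 7 s₁ ∧
        s₁.out = s.out ∧
        s₁.reg 3 = (∑ i ∈ Finset.range (j + 1), if xs.getD (a + i * c) 0 = 0 then 0 else 2 ^ i) ∧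
        ∀ r, r ≠ 3 → s₁.reg r = s'.reg r := by
      by_cases h0 : xs.getD (a + j * c) 0 = 0
      · refine ⟨s', (Reaches.ite_false (by simp only [Expr.eval, h4, h0]) Reaches.skip).mono
          (by simp [Expr.cost]), h1, ?_, fun _ _ => rfl⟩
        rw [Finset.sum_range_succ, if_pos h0, h2, add_zero]
      · refine ⟨_, Reaches.ite_true (by simpa only [Expr.eval, h4] using h0) Reaches.setReg,
          h1, ?_, fun r hr => by simp [hr]⟩
        rw [Finset.sum_range_succ, if_neg h0]
        simp [Expr.eval, h2, h3]
    obtain ⟨s₁, hr, ho, hv, hk⟩ := hite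
    refine ⟨_, (hr.seq (Reaches.setReg.seq (Reaches.setReg.seq Reaches.setReg))).mono
      (by simp [Expr.cost]), ho, ?_, ?_, ?_, ?_, ?_⟩
    · simpa using hv
    · simp [Expr.eval, hk, h3, pow_succ, mul_two]
    · simp [Expr.eval, hk, h4, hc, Nat.succ_mul, add_assoc]
    · simp [Expr.eval, hk, h5]
      omega
    · intro r hr hne
      have : r ≠ 7 ∧ r ≠ 8 ∧ r ≠ 9 := by omega
      simp only [ne_eq, this, not_false_eq_true, Function.update_of_ne]
      rw [hk r hne, h6 r hr hne]
  let s₀ : State := ⟨Function.update (Function.update (Function.update (Function.update s.reg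
    3 0) 7 1) 8 a) 9 (s.reg 0), s.mem, s.out⟩
  have hinv : Inv 0 s₀ := by
    refine ⟨rfl, by simp [s₀], by simp [s₀], by simp [s₀], by simp [s₀], fun r hr hne => ?_⟩
    have : r ≠ 7 ∧ r ≠ 8 ∧ r ≠ 9 := by omega
    simp [s₀, this, hne]
  obtain ⟨s₁, hr, ho, hv, -, -, -, hk⟩ := Reaches.loop Inv (s.reg 0) 28 hstep
    (fun s' hs' => by simp [Expr.eval, hs'.2.2.2.2.1]) hinv
  refine ⟨s₁, ?_, ho, hv, hk⟩
  have h4 : Reaches xs (.setReg 9 (.reg 0)) ⟨Function.update (Function.update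
      (Function.update s.reg 3 0) 7 1) 8 a, s.mem, s.out⟩ 2 s₀ := Reaches.setReg
  have h3 : Reaches xs (.setReg 8 (.plus (.plus (.plus (.lit 4)
      (.plus (.inp (.lit 3)) (.inp (.lit 3)))) (.inp (.lit 2))) (.reg 6)))
      ⟨Function.update (Function.update s.reg 3 0) 7 1, s.mem, s.out⟩ 13
      ⟨Function.update (Function.update (Function.update s.reg 3 0) 7 1) 8 a, s.mem, s.out⟩ :=
    Reaches.setReg.mono (by simp [Expr.cost])
  have h2 : Reaches xs (.setReg 7 (.lit 1)) ⟨Function.update s.reg 3 0, s.mem, s.out⟩ 2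
      ⟨Function.update (Function.update s.reg 3 0) 7 1, s.mem, s.out⟩ := Reaches.setReg
  have h1 : Reaches xs (.setReg 3 (.lit 0)) s 2 ⟨Function.update s.reg 3 0, s.mem, s.out⟩ :=
    Reaches.setReg
  exact (h1.seq (h2.seq (h3.seq (h4.seq hr)))).mono (by simp [Expr.cost]; omega)

/-- The cover algorithm, given programs for the numbers `m` and `l` and for the bits. -/
def coverProg (Pm Pl Pb : Prog) : Prog :=
  .seq (.setReg 0 (.inp (.lit 0))) (.seq (.setReg 1 (.inp (.lit 1))) (.seq Pm
    (.seq (.output (.reg 4)) (.seq Pl (.seq (.output (.reg 5))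
      (.loop (.minus (.reg 4) (.reg 2)) (.seq (.setReg 6 (.lit 0)) (.seq
        (.loop (.minus (.inp (.lit 3)) (.reg 6)) (.seq maskProg (.seq Pb
          (.seq (.output (.reg 5)) (.setReg 6 (.plus (.reg 6) (.lit 1)))))))
        (.setReg 2 (.plus (.reg 2) (.lit 1)))))))))))

/-- The algorithm writes the optimal cover of an instance given by the input `xs`. -/
theorem exists_coverProg : ∃ (P : Prog) (A : ℕ → ℕ → ℕ), ∀ (k k' n q : ℕ) (xs : List ℕ),
    xs.getD 0 0 = k → xs.getD 1 0 = k' → xs.getD 2 0 = n → xs.getD 3 0 = q →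
    ∃ t ≤ A k k' * (q + 1), Outputs P xs t
      ([(coverList k k').length, k.factorial * k.factorial] ++
        ((List.range (coverList k k').length).map fun i =>
          (List.range q).map fun e => coverBit k k' i (∑ i ∈ Finset.range k,
            if xs.getD (4 + (q + q) + n + e + i * (n + q)) 0 = 0
              then 0 else 2 ^ i)).flatten) := by
  -- The bound `10` protects the registers used by the surrounding loops. Register `5` first holds
  -- `l` and is reused for the bits once `l` has been written.
  obtain ⟨Pm, hPm⟩ := exists_computes primrec'_length_coverList ![0, 1] 4 10
    (by decide) (by norm_num)
  obtain ⟨Pl, hPl⟩ := exists_computes primrec'_factorial_mul_factorial ![0] 5 10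
    (by decide) (by norm_num)
  obtain ⟨Pb, hPb⟩ := exists_computes primrec'_coverBit ![0, 1, 2, 3] 5 10
    (by decide) (by norm_num)
  choose tm hm using hPm
  choose tl hl using hPl
  choose tb hb using hPb
  -- Since a mask is below `2 ^ k`, summing over all spider indices and masks bounds the time for
  -- one bit in terms of `k` and `k'` alone.
  let B : ℕ → ℕ → ℕ := fun k k' => ∑ p ∈ Finset.range (coverList k k').length ×ˢ
    Finset.range (2 ^ k), tb (k ::ᵥ k' ::ᵥ p.1 ::ᵥ p.2 ::ᵥ List.Vector.nil)
  refine ⟨coverProg Pm Pl Pb, fun k k' => 10 + tm (k ::ᵥ k' ::ᵥ List.Vector.nil) +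
    tl (k ::ᵥ List.Vector.nil) + ((coverList k k').length + 1) *
      (10 + (5 + (20 + (k + 1) * 30 + B k k' + 6))), ?_⟩
  intro k k' n q xs hx0 hx1 hx2 hx3
  set m := (coverList k k').length with hm_def
  set l := k.factorial * k.factorial with hl_def
  let mask : ℕ → ℕ := fun e => ∑ i ∈ Finset.range k,
    if xs.getD (4 + (q + q) + n + e + i * (n + q)) 0 = 0 then 0 else 2 ^ i
  have hmask : ∀ e, mask e < 2 ^ k := by
    intro e
    have h1 : mask e ≤ ∑ i ∈ Finset.range k, 2 ^ i :=
      Finset.sum_le_sum fun i _ => by split_ifs <;> simp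
    have h2 : ∑ i ∈ Finset.range k, 2 ^ i < 2 ^ k := by
      rw [Nat.geomSum_eq le_rfl]
      have := Nat.two_pow_pos k
      simp
    exact h1.trans_lt h2
  let row : ℕ → ℕ → List ℕ := fun i e => (List.range e).map fun e => coverBit k k' i (mask e)
  let InvI : ℕ → List ℕ → ℕ → State → Prop := fun i o e s => s.reg 0 = k ∧ s.reg 1 = k' ∧
    s.reg 2 = i ∧ s.reg 4 = m ∧ s.reg 6 = e ∧ s.out = o ++ row i e
  let D := 20 + (k + 1) * 30 + B k k' + 6
  have hinner : ∀ i < m, ∀ o e, e < q → ∀ s, InvI i o e s →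
      (Expr.minus (.inp (.lit 3)) (.reg 6)).eval xs s ≠ 0 ∧
      ∃ s', Reaches xs (.seq maskProg (.seq Pb
          (.seq (.output (.reg 5)) (.setReg 6 (.plus (.reg 6) (.lit 1)))))) s D s' ∧
        InvI i o (e + 1) s' := by
    rintro i hi o e he s ⟨h0, h1, h2, h4, h6, ho⟩
    refine ⟨by simp only [Expr.eval, hx3, h6]; omega, ?_⟩
    obtain ⟨s₁, hr₁, ho₁, hv₁, hk₁⟩ := maskProg_reaches xs s
    rw [h0, h6, hx2, hx3] at hv₁
    obtain ⟨s₂, hr₂, -, ho₂, hv₂, hk₂⟩ :=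
      hb (k ::ᵥ k' ::ᵥ i ::ᵥ mask e ::ᵥ List.Vector.nil) xs s₁ (by
        intro j
        fin_cases j
        · exact (hk₁ 0 (by norm_num) (by norm_num)).trans h0
        · exact (hk₁ 1 (by norm_num) (by norm_num)).trans h1
        · exact (hk₁ 2 (by norm_num) (by norm_num)).trans h2
        · exact hv₁)
    refine ⟨_, (hr₁.seq (hr₂.seq (Reaches.output.seq Reaches.setReg))).mono ?_,
      ?_, ?_, ?_, ?_, ?_, ?_⟩
    · have hmem : (i, mask e) ∈ Finset.range (coverList k k').length ×ˢ Finset.range (2 ^ k) :=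
        Finset.mk_mem_product (Finset.mem_range.2 hi) (Finset.mem_range.2 (hmask e))
      have hB : tb (k ::ᵥ k' ::ᵥ i ::ᵥ mask e ::ᵥ List.Vector.nil) ≤ B k k' :=
        Finset.single_le_sum
          (f := fun p : ℕ × ℕ => tb (k ::ᵥ k' ::ᵥ p.1 ::ᵥ p.2 ::ᵥ List.Vector.nil))
          (fun _ _ => Nat.zero_le _) hmem
      simp only [Expr.cost, h0, D]
      omega
    · simp [hk₂ 0, hk₁ 0, h0]
    · simp [hk₂ 1, hk₁ 1, h1]
    · simp [hk₂ 2, hk₁ 2, h2]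
    · simp [hk₂ 4, hk₁ 4, h4]
    · simp [Expr.eval, hk₂ 6, hk₁ 6, h6]
    · simp only [Expr.eval, hv₂, ho₂, ho₁, ho, row, List.range_succ, List.map_append,
        List.append_assoc]
      rfl
  let InvO : ℕ → State → Prop := fun i s => s.reg 0 = k ∧ s.reg 1 = k' ∧
    s.reg 2 = i ∧ s.reg 4 = m ∧
    s.out = [m, l] ++ ((List.range i).map fun i => row i q).flatten
  have houter : ∀ i < m, ∀ s, InvO i s →
      (Expr.minus (.reg 4) (.reg 2)).eval xs s ≠ 0 ∧
      ∃ s', Reaches xs (.seq (.setReg 6 (.lit 0)) (.seq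
        (.loop (.minus (.inp (.lit 3)) (.reg 6)) (.seq maskProg (.seq Pb
          (.seq (.output (.reg 5)) (.setReg 6 (.plus (.reg 6) (.lit 1)))))))
        (.setReg 2 (.plus (.reg 2) (.lit 1))))) s (6 + (q + 1) * (5 + D)) s' ∧
        InvO (i + 1) s' := by
    rintro i hi s ⟨h0, h1, h2, h4, ho⟩
    refine ⟨by simp only [Expr.eval, h4, h2]; omega, ?_⟩
    obtain ⟨s₁, hr₁, h0', h1', h2', h4', h6', ho'⟩ := Reaches.loop
      (s := ⟨Function.update s.reg 6 0, s.mem, s.out⟩) (InvI i s.out) q D (hinner i hi s.out)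
      (fun s hs => by simp only [Expr.eval, hs.2.2.2.2.1, hx3, Nat.sub_self])
      ⟨by simpa, by simpa, by simpa, by simpa, by simp, by simp [row]⟩
    refine ⟨_, ((show Reaches xs (.setReg 6 (.lit 0)) s 2
      ⟨Function.update s.reg 6 0, s.mem, s.out⟩ from Reaches.setReg).seq
        (hr₁.seq Reaches.setReg)).mono (by simp [Expr.cost]; omega), ?_, ?_, ?_, ?_, ?_⟩
    · simpa using h0'
    · simpa using h1'
    · simp [Expr.eval, h2']
    · simpa using h4'
    · simp [ho', ho, List.range_succ]
  obtain ⟨s₁, hr₁, -, ho₁, hv₁, hk₁⟩ := hm (k ::ᵥ k' ::ᵥ List.Vector.nil) xs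
    ⟨Function.update (Function.update State.init.reg 0 k) 1 k', State.init.mem, []⟩ (by
      intro j
      fin_cases j <;> rfl)
  obtain ⟨s₂, hr₂, -, ho₂, hv₂, hk₂⟩ := hl (k ::ᵥ List.Vector.nil) xs
    ⟨s₁.reg, s₁.mem, [m]⟩ (by
      intro j
      fin_cases j
      exact hk₁ 0 (by norm_num) (by norm_num))
  obtain ⟨s₃, hr₃, -, -, -, -, ho₃⟩ := Reaches.loop
    (s := ⟨s₂.reg, s₂.mem, [m, l]⟩) InvO m _ houter
    (fun s hs => by simp [Expr.eval, hs.2.2.1, hs.2.2.2.1])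
    ⟨(hk₂ 0 (by norm_num) (by norm_num)).trans (hk₁ 0 (by norm_num) (by norm_num)),
      (hk₂ 1 (by norm_num) (by norm_num)).trans (hk₁ 1 (by norm_num) (by norm_num)),
      -- The spider index in register `2` starts from the zero of the initial state.
      (hk₂ 2 (by norm_num) (by norm_num)).trans (hk₁ 2 (by norm_num) (by norm_num)),
      (hk₂ 4 (by norm_num) (by norm_num)).trans hv₁, by simp⟩
  have e1 : Reaches xs (.setReg 0 (.inp (.lit 0))) State.init 3
      ⟨Function.update State.init.reg 0 k, State.init.mem, []⟩ := by
    rw [← hx0]; exact Reaches.setReg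
  have e2 : Reaches xs (.setReg 1 (.inp (.lit 1)))
      ⟨Function.update State.init.reg 0 k, State.init.mem, []⟩ 3
      ⟨Function.update (Function.update State.init.reg 0 k) 1 k', State.init.mem, []⟩ := by
    rw [← hx1]; exact Reaches.setReg
  have e3 : Reaches xs (.output (.reg 4)) s₁ 2 ⟨s₁.reg, s₁.mem, [m]⟩ := by
    have h := Reaches.output (xs := xs) (s := s₁) (a := .reg 4)
    simp only [Expr.eval, hv₁, ho₁] at h
    exact h
  have e4 : Reaches xs (.output (.reg 5)) s₂ 2 ⟨s₂.reg, s₂.mem, [m, l]⟩ := by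
    have h := Reaches.output (xs := xs) (s := s₂) (a := .reg 5)
    simp only [Expr.eval, hv₂, ho₂] at h
    exact h
  obtain ⟨t, ht, h⟩ := e1.seq (e2.seq (hr₁.seq (e3.seq (hr₂.seq (e4.seq hr₃)))))
  refine ⟨t, ht.trans ?_, s₃, h, ho₃⟩
  simp only [Expr.cost]
  change _ ≤ (10 + tm (k ::ᵥ k' ::ᵥ List.Vector.nil) +
    tl (k ::ᵥ List.Vector.nil) + (m + 1) * (10 + (5 + D))) * (q + 1)
  have h5 : (m + 1) * (1 + 1 + 1 + 1 + (6 + (q + 1) * (5 + D))) ≤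
      ((m + 1) * (10 + (5 + D))) * (q + 1) := by
    rw [mul_assoc]
    refine Nat.mul_le_mul_left _ ?_
    rw [add_mul 10, mul_comm (5 + D)]
    omega
  have h6 : 10 + tm (k ::ᵥ k' ::ᵥ List.Vector.nil) + tl (k ::ᵥ List.Vector.nil) ≤
      (10 + tm (k ::ᵥ k' ::ᵥ List.Vector.nil) + tl (k ::ᵥ List.Vector.nil)) * (q + 1) :=
    Nat.le_mul_of_pos_right _ q.succ_pos
  have h7 := add_le_add h6 h5
  rw [← add_mul] at h7
  refine le_trans ?_ h7
  omega

end RAM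

/-! ### Assembly of the two parts. -/

theorem mainTheorem8 :
    -- the value of the least ratio, and an instance on which no better ratio is possible
    (∀ (k k' : ℕ) (hk' : 1 ≤ k'), k' ≤ k →
      IsLeast (laminarCoverRatios.{u, v} k k') (laminarCoverValue k k' hk') ∧
      ∃ (α : Type u) (β : Type v) (I : SAPInstance α β k),
        I.EdgesInAtMost k' ∧
        (∀ i, ∀ z ∈ V(I.H i), ∃ e, (I.H i).Inc e z) ∧
        ∀ (m l : ℕ) (F : Fin m → Set β), 0 < l → I.IsLaminarCover m l F →
          laminarCoverValue k k' hk' ≤ (m : ℚ) / l) ∧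
    -- one algorithm constructs optimal covers in `O(f(k) poly(|V|, |E|))` steps
    (∃ (P : RAM.Prog) (f : ℕ → ℕ) (p : MvPolynomial (Fin 2) ℕ),
      ∀ (k k' : ℕ) (hk' : 1 ≤ k'), k' ≤ k →
        ∀ (n q : ℕ) (I : SAPInstance (Fin n) (Fin q) k) (x y : Fin q → Fin n),
          V(I.G) = Set.univ → E(I.G) = Set.univ → (∀ a, I.G.IsLink a (x a) (y a)) →
          I.EdgesInAtMost k' →
          ∃ (m l : ℕ) (F : Fin m → Set (Fin q)) (t : ℕ),
            0 < l ∧ (m : ℚ) / l = laminarCoverValue k k' hk' ∧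
            I.IsLaminarCover m l F ∧
            RAM.Outputs P (encodeInstance k' I x y) t (encodeCover m l F) ∧
            t ≤ f k * MvPolynomial.eval ![n, q] p) := by
  refine ⟨fun k k' hk' hk => ⟨isLeast_laminarCoverRatios hk' hk, _, _,
    allTypesInstance k k' hk', allTypesInstance_edgesInAtMost hk',
    allTypesInstance_exists_inc hk',
    fun m l F hl hF => laminarCoverValue_le_of_isLaminarCover hk' hk hl hF⟩, ?_⟩
  obtain ⟨P, A, h⟩ := RAM.exists_coverProg
  -- The bound may depend on `k` but not on `k'`, hence the sum over `k' ≤ k`. The polynomial is the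
  -- number of edges plus one.
  refine ⟨P, fun k => ∑ k' ∈ Finset.range (k + 1), A k k', MvPolynomial.X 1 + 1, ?_⟩
  intro k k' hk' hk n q I x y _ hE _ hI
  obtain ⟨t, ht, hout⟩ := h k k' n q (encodeInstance k' I x y)
    (encodeInstance_getD_zero k' I x y) (encodeInstance_getD_one k' I x y)
    (encodeInstance_getD_two k' I x y) (encodeInstance_getD_three k' I x y)
  refine ⟨(coverList k k').length, k.factorial * k.factorial, I.spiderCover k', t,
    Nat.mul_pos k.factorial_pos k.factorial_pos, length_coverList_div_eq hk' hk,
    I.isLaminarCover_spiderCover hk' hk hI, ?_, ?_⟩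
  · rw [encodeCover_spiderCover k' I x y hE]
    exact hout
  · refine ht.trans ?_
    simp only [map_add, MvPolynomial.eval_X, map_one, Matrix.cons_val_one, Matrix.cons_val_fin_one]
    exact Nat.mul_le_mul_right _ (Finset.single_le_sum (f := A k) (fun _ _ => Nat.zero_le _)
      (Finset.mem_range.2 (Nat.lt_succ_of_le hk)))
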